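/- Let $\mathcal F^2$ be the Fock space of entire functions $F:\mathbb C\to\mathbb C$ with $\|F\|^2=\int_{\mathbb C}|F(z)|^2e^{-\pi|z|^2}\,dA(z)<\infty$, where $dA$ is Lebesgue measure, and let $P$ be the orthogonal projection of $L^2(\mathbb C,e^{-\pi|z|^2}dA)$ onto $\mathcal F^2$. For a measurable set $\Omega\subset\mathbb C$ of finite area $|\Omega|>0$, let $T_\Omega=P\chi_\Omega:\mathcal F^2\to\mathcal F^2$ be the corresponding Toeplitz operator (which is compact and positive) and let $\lambda_1(\Omega)\ge\lambda_2(\Omega)\ge\cdots>0$ be its eigenvalues, listed in decreasing order and repeated according to multiplicity. A measurable set $\Omega$ is called circularly symmetric if $\Omega=\{z\in\mathbb C:\ |z-w|\in E\}$ for some $w\in\mathbb C$ and some measurable $E\subset[0,\infty)$. Two measurable sets are called equivalent if their symmetric difference has measure zero. **Theorem.** Let $\Omega\subset\mathbb C$ be circularly symmetric with $0<|\Omega|<\infty$, let $\Omega^*$ be an open disc with $|\Omega^*|=|\Omega|$, and let $\Phi:(0,1)\to\mathbb R$ be convex. Then the series $\sum_{k=1}^\infty\Phi(\lambda_k(\Omega))$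 and $\sum_{k=1}^\infty\Phi(\lambda_k(\Omega^*))$ have well-defined sums in $[-\infty,+\infty]$ (as limits of their partial sums), and $$\sum_{k=1}^{\infty}\Phi(\lambda_k(\Omega))\le\sum_{k=1}^{\infty}\Phi(\lambda_k(\Omega^*)).$$ Moreover, if the sum on the right is finite and $\Phi$ is not affine on $(0,\lambda_1(\Omega^*))$, then equality holds if and only if $\Omega$ is equivalent to a translate of $\Omega^*$. -/

import Mathlib

open MeasureTheory Filter Topology
open scoped ENNReal

namespace Fock

/-- The measure `e^{-π|z|²} dA(z)` on `ℂ`. -/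
noncomputable def gaussianMeasure : Measure ℂ :=
  volume.withDensity fun z => ENNReal.ofReal (Real.exp (-Real.pi * ‖z‖ ^ 2))

lemma measurable_weight :
    Measurable fun z : ℂ => ENNReal.ofReal (Real.exp (-Real.pi * ‖z‖ ^ 2)) := by
  fun_prop

instance : IsFiniteMeasure gaussianMeasure := by
  have h := GaussianFourier.integrable_cexp_neg_mul_sq_norm_add (V := ℂ) (b := (Real.pi : ℂ))
    (by simpa using Real.pi_pos) 0 0
  have h2 : Integrable (fun z : ℂ => Real.exp (-Real.pi * ‖z‖ ^ 2)) volume := by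
    refine h.norm.congr (ae_of_all _ fun z => ?_)
    simp only [Complex.norm_exp]
    congr 1
    rw [zero_mul, add_zero, ← Complex.ofReal_neg, ← Complex.ofReal_pow, ← Complex.ofReal_mul,
      Complex.ofReal_re]
  exact isFiniteMeasure_withDensity_ofReal h2.2

lemma gaussianMeasure_absolutelyContinuous : gaussianMeasure ≪ volume :=
  withDensity_absolutelyContinuous _ _

lemma ae_volume_of_ae {p : ℂ → Prop} (h : ∀ᵐ z ∂gaussianMeasure, p z) : ∀ᵐ z, p z := by
  rw [gaussianMeasure, ae_withDensity_iff measurable_weight] at h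
  filter_upwards [h] with z hz
  exact hz (by simp [Real.exp_pos])

lemma enorm_le_circle {F : ℂ → ℂ} (hF : Differentiable ℂ F) (z : ℂ) (r : ℝ) :
    ‖F z‖ₑ ≤ ∫⁻ θ in Set.Ioo (-Real.pi) Real.pi,
      ‖F (z + r * (Real.cos θ + Real.sin θ * Complex.I))‖ₑ := by
  have h1 : Real.circleAverage F z r = F z := hF.diffContOnCl.circleAverage
  have hp : Function.Periodic (fun θ => F (circleMap z r θ)) (2 * Real.pi) := fun θ => by
    simp only [periodic_circleMap z r θ]
  have h2 := hp.intervalIntegral_add_eq 0 (-Real.pi)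
  rw [Real.circleAverage_def] at h1
  rw [zero_add] at h2
  rw [h2, show -Real.pi + 2 * Real.pi = Real.pi by ring,
    intervalIntegral.integral_of_le (by linarith [Real.pi_pos]),
    integral_Ioc_eq_integral_Ioo] at h1
  rw [← h1, enorm_smul]
  have h3 : ‖(2 * Real.pi)⁻¹‖ₑ ≤ 1 := by
    rw [← ofReal_norm, ENNReal.ofReal_le_one, Real.norm_eq_abs, abs_of_pos (by positivity)]
    exact inv_le_one_of_one_le₀ (by linarith [Real.pi_gt_three])
  refine (mul_le_mul' h3 (enorm_integral_le_lintegral_enorm _)).trans ?_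
  rw [one_mul]
  refine le_of_eq (lintegral_congr fun θ => ?_)
  simp only [circleMap, Complex.exp_mul_I, Complex.ofReal_cos, Complex.ofReal_sin]

lemma enorm_le_ball {F : ℂ → ℂ} (hF : Differentiable ℂ F) (z : ℂ) :
    ‖F z‖ₑ ≤ ∫⁻ w in Metric.ball z 2, ‖F w‖ₑ := by
  have hc := hF.continuous
  rw [← lintegral_indicator Metric.isOpen_ball.measurableSet,
    ← lintegral_add_left_eq_self _ z, ← Complex.lintegral_comp_polarCoord_symm]
  have hsub : Set.Ioo (1 : ℝ) 2 ×ˢ Set.Ioo (-Real.pi) Real.pi ⊆ polarCoord.target := by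
    rw [polarCoord_target]
    exact Set.prod_mono (fun r hr => lt_trans one_pos hr.1) subset_rfl
  refine le_trans ?_ (lintegral_mono_set hsub)
  have hms : MeasurableSet (Set.Ioo (1 : ℝ) 2 ×ˢ Set.Ioo (-Real.pi) Real.pi) :=
    measurableSet_Ioo.prod measurableSet_Ioo
  calc ‖F z‖ₑ = ∫⁻ _r in Set.Ioo (1 : ℝ) 2, ‖F z‖ₑ := by
        rw [setLIntegral_const, Real.volume_Ioo]; norm_num
    _ ≤ ∫⁻ r in Set.Ioo (1 : ℝ) 2, ∫⁻ θ in Set.Ioo (-Real.pi) Real.pi,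
          ‖F (z + r * (Real.cos θ + Real.sin θ * Complex.I))‖ₑ :=
        lintegral_mono fun r => enorm_le_circle hF z r
    _ = ∫⁻ p in Set.Ioo (1 : ℝ) 2 ×ˢ Set.Ioo (-Real.pi) Real.pi,
          ‖F (z + p.1 * (Real.cos p.2 + Real.sin p.2 * Complex.I))‖ₑ := by
        rw [Measure.volume_eq_prod, setLIntegral_prod]
        fun_prop
    _ ≤ _ := by
        refine setLIntegral_mono' hms fun p hp => ?_
        have hn : ‖(Complex.polarCoord.symm p)‖ = p.1 := by
          rw [Complex.norm_polarCoord_symm, abs_of_pos (lt_trans one_pos hp.1.1)]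
        rw [Set.indicator_of_mem (by
          rw [Metric.mem_ball, dist_eq_norm, add_sub_cancel_left, hn]; exact hp.1.2), smul_eq_mul,
          Complex.polarCoord_symm_apply]
        exact le_mul_of_one_le_left' (by simpa using hp.1.1.le)

lemma enorm_le_eLpNorm (R : ℝ) : ∃ C : ℝ≥0∞, C ≠ ∞ ∧ ∀ F : ℂ → ℂ, Differentiable ℂ F →
    ∀ z : ℂ, ‖z‖ ≤ R → ‖F z‖ₑ ≤ C * eLpNorm F 2 gaussianMeasure := by
  refine ⟨ENNReal.ofReal (Real.exp (Real.pi * (R + 2) ^ 2)) *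
    gaussianMeasure Set.univ ^ (1 / (1 : ℝ≥0∞).toReal - 1 / (2 : ℝ≥0∞).toReal),
    ENNReal.mul_ne_top ENNReal.ofReal_ne_top
      (ENNReal.rpow_ne_top_of_nonneg (by norm_num) (measure_ne_top _ _)), fun F hF z hz => ?_⟩
  have hc := hF.continuous
  refine (enorm_le_ball hF z).trans ?_
  calc ∫⁻ w in Metric.ball z 2, ‖F w‖ₑ
      ≤ ∫⁻ w in Metric.ball z 2, ENNReal.ofReal (Real.exp (Real.pi * (R + 2) ^ 2)) *
          (ENNReal.ofReal (Real.exp (-Real.pi * ‖w‖ ^ 2)) * ‖F w‖ₑ) := by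
        refine setLIntegral_mono' Metric.isOpen_ball.measurableSet fun w hw => ?_
        rw [← mul_assoc, ← ENNReal.ofReal_mul (Real.exp_pos _).le, ← Real.exp_add]
        refine le_mul_of_one_le_left' ?_
        rw [ENNReal.one_le_ofReal, Real.one_le_exp_iff]
        have h1 : ‖w‖ ≤ R + 2 := by
          have h2 := norm_sub_norm_le w z
          rw [Metric.mem_ball, dist_eq_norm] at hw
          linarith
        have h3 : ‖w‖ ^ 2 ≤ (R + 2) ^ 2 := pow_le_pow_left₀ (norm_nonneg _) h1 2
        nlinarith [Real.pi_pos]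
    _ ≤ ∫⁻ w, ENNReal.ofReal (Real.exp (Real.pi * (R + 2) ^ 2)) *
          (ENNReal.ofReal (Real.exp (-Real.pi * ‖w‖ ^ 2)) * ‖F w‖ₑ) :=
        setLIntegral_le_lintegral _ _
    _ = ENNReal.ofReal (Real.exp (Real.pi * (R + 2) ^ 2)) * eLpNorm F 1 gaussianMeasure := by
        rw [lintegral_const_mul' _ _ ENNReal.ofReal_ne_top, eLpNorm_one_eq_lintegral_enorm,
          gaussianMeasure, lintegral_withDensity_eq_lintegral_mul _ measurable_weight
            (by fun_prop)]
        rfl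
    _ ≤ _ := by
        rw [mul_assoc]
        gcongr
        rw [mul_comm]
        exact eLpNorm_le_eLpNorm_mul_rpow_measure_univ (by norm_num) hc.aestronglyMeasurable

/-- The Fock space: the classes in `L²(ℂ, e^{-π|z|²} dA)` of the entire functions with
`∫ |F|² e^{-π|z|²} dA < ∞`. -/
noncomputable def fockSpace : Submodule ℂ (Lp ℂ 2 gaussianMeasure) where
  carrier := {f | ∃ F : ℂ → ℂ, Differentiable ℂ F ∧ f =ᵐ[gaussianMeasure] F}
  zero_mem' := ⟨0, differentiable_const 0, Lp.coeFn_zero _ _ _⟩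
  add_mem' := by
    rintro f g ⟨F, hF, hf⟩ ⟨G, hG, hg⟩
    exact ⟨F + G, hF.add hG, (Lp.coeFn_add f g).trans (hf.add hg)⟩
  smul_mem' := by
    rintro c f ⟨F, hF, hf⟩
    exact ⟨c • F, hF.const_smul c, (Lp.coeFn_smul c f).trans (hf.const_smul c)⟩

lemma isClosed_fockSpace : IsClosed (fockSpace : Set (Lp ℂ 2 gaussianMeasure)) := by
  rw [← isSeqClosed_iff_isClosed]
  intro f g hf hlim
  choose F hF hfF using hf
  have key : ∀ R : ℝ, UniformCauchySeqOn F atTop (Metric.closedBall 0 R) := by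
    intro R
    obtain ⟨C, hC, hCF⟩ := enorm_le_eLpNorm R
    rw [Metric.uniformCauchySeqOn_iff]
    intro ε hε
    have hcs : CauchySeq f := hlim.cauchySeq
    rw [Metric.cauchySeq_iff] at hcs
    obtain ⟨N, hN⟩ := hcs (ε / (C.toReal + 1)) (by positivity)
    refine ⟨N, fun m hm n hn z hz => ?_⟩
    have h1 := hCF (F m - F n) ((hF m).sub (hF n)) z (by simpa using hz)
    have h2 : eLpNorm (F m - F n) 2 gaussianMeasure = ‖f m - f n‖ₑ := by
      rw [Lp.enorm_def]
      exact eLpNorm_congr_ae ((Lp.coeFn_sub _ _).trans ((hfF m).sub (hfF n))).symm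
    rw [h2] at h1
    have h3 := ENNReal.toReal_mono (ENNReal.mul_ne_top hC enorm_ne_top) h1
    rw [ENNReal.toReal_mul, toReal_enorm, toReal_enorm] at h3
    rw [dist_eq_norm]
    have h4 := hN m hm n hn
    rw [dist_eq_norm, lt_div_iff₀ (by positivity)] at h4
    have h5 : ‖(F m - F n) z‖ = ‖F m z - F n z‖ := rfl
    have h6 : (0 : ℝ) ≤ ‖f m - f n‖ := norm_nonneg _
    nlinarith
  have hpt : ∀ z, ∃ w, Tendsto (fun n => F n z) atTop (𝓝 w) := fun z =>
    cauchySeq_tendsto_of_complete ((key ‖z‖).cauchySeq (by simp))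
  choose G hG using hpt
  have hloc : TendstoLocallyUniformlyOn F G atTop Set.univ := by
    rw [tendstoLocallyUniformlyOn_iff_forall_isCompact isOpen_univ]
    intro K _ hK
    obtain ⟨R, hR⟩ := hK.isBounded.subset_closedBall 0
    exact ((key R).tendstoUniformlyOn_of_tendsto fun z _ => hG z).mono hR
  have hGd : Differentiable ℂ G := by
    rw [← differentiableOn_univ]
    exact hloc.differentiableOn (Eventually.of_forall fun n => (hF n).differentiableOn) isOpen_univ
  refine ⟨G, hGd, ?_⟩
  obtain ⟨ns, hns, hae⟩ := (tendstoInMeasure_of_tendsto_eLpNorm (by norm_num)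
    (fun n => Lp.aestronglyMeasurable (f n)) (Lp.aestronglyMeasurable g)
    ((Lp.tendsto_Lp_iff_tendsto_eLpNorm' f g).1 hlim)).exists_seq_tendsto_ae
  filter_upwards [hae, ae_all_iff.2 hfF] with z h1 h2
  refine tendsto_nhds_unique h1 ?_
  simp only [h2]
  exact (hG z).comp hns.tendsto_atTop

instance : CompleteSpace fockSpace := isClosed_fockSpace.completeSpace_coe

/-- Multiplication by the characteristic function of `Ω` on `L²(ℂ, e^{-π|z|²} dA)`. -/
noncomputable def mulIndicator (Ω : Set ℂ) (hΩ : NullMeasurableSet Ω volume) :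
    Lp ℂ 2 gaussianMeasure →L[ℂ] Lp ℂ 2 gaussianMeasure :=
  have hmem : ∀ f : Lp ℂ 2 gaussianMeasure, MemLp (Ω.indicator f) 2 gaussianMeasure := fun f =>
    ⟨(Lp.aestronglyMeasurable f).indicator₀ (hΩ.mono_ac gaussianMeasure_absolutelyContinuous),
      (eLpNorm_indicator_le _).trans_lt (Lp.eLpNorm_lt_top f)⟩
  LinearMap.mkContinuous
    { toFun := fun f => (hmem f).toLp (Ω.indicator f)
      map_add' := fun f g => by
        rw [← MemLp.toLp_add]
        refine MemLp.toLp_congr _ _ ?_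
        filter_upwards [Lp.coeFn_add f g] with z hz
        by_cases h : z ∈ Ω
        · simpa only [Pi.add_apply, Set.indicator_of_mem h] using hz
        · simp only [Pi.add_apply, Set.indicator_of_notMem h, add_zero]
      map_smul' := fun c f => by
        rw [RingHom.id_apply, ← MemLp.toLp_const_smul]
        refine MemLp.toLp_congr _ _ ?_
        filter_upwards [Lp.coeFn_smul c f] with z hz
        by_cases h : z ∈ Ω
        · simpa only [Pi.smul_apply, Set.indicator_of_mem h] using hz
        · simp only [Pi.smul_apply, Set.indicator_of_notMem h, smul_zero] }
    1 fun f => by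
      rw [one_mul, LinearMap.coe_mk, AddHom.coe_mk, Lp.norm_toLp, Lp.norm_def]
      exact ENNReal.toReal_mono (Lp.eLpNorm_ne_top f) (eLpNorm_indicator_le _)

/-- The Toeplitz operator `T_Ω = P χ_Ω` on the Fock space, `P` being the orthogonal projection
of `L²(ℂ, e^{-π|z|²} dA)` onto the Fock space. -/
noncomputable def toeplitz (Ω : Set ℂ) (hΩ : NullMeasurableSet Ω volume) :
    fockSpace →L[ℂ] fockSpace :=
  fockSpace.orthogonalProjectionOnto ∘L mulIndicator Ω hΩ ∘L fockSpace.subtypeL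

/-- The `n`-th eigenvalue (`n ≥ 1`) of a compact positive operator `T`, the positive eigenvalues
being listed in decreasing order and repeated according to their multiplicity: the largest `t > 0`
such that the eigenspaces of `T` for the eigenvalues `μ ≥ t` span a space of dimension at
least `n`. -/
noncomputable def nthEigenvalue {H : Type*} [NormedAddCommGroup H] [InnerProductSpace ℂ H]
    (T : H →L[ℂ] H) (n : ℕ) : ℝ :=
  sSup {t : ℝ | 0 < t ∧ (n : Cardinal) ≤
    Module.rank ℂ ↥(⨆ μ ∈ Set.Ici t, Module.End.eigenspace (T : H →ₗ[ℂ] H) (μ : ℂ))}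

/-- `Ω` is the set of the points whose distance from some centre `w` lies in some measurable set
`E` of nonnegative reals. -/
def IsCircularlySymmetric (Ω : Set ℂ) : Prop :=
  ∃ (w : ℂ) (E : Set ℝ), E ⊆ Set.Ici 0 ∧ NullMeasurableSet E volume ∧ Ω = {z | ‖z - w‖ ∈ E}

/-- Two sets are equivalent if their symmetric difference is a null set. -/
def EquivalentSets (A B : Set ℂ) : Prop := volume (symmDiff A B) = 0

/-- The series `∑_{k ≥ 1} a k` has the sum `S` in `[-∞, +∞]`, as the limit of its partial sums. -/
def HasExtendedSum (a : ℕ → ℝ) (S : EReal) : Prop :=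
  Tendsto (fun N : ℕ => ((∑ k ∈ Finset.Icc 1 N, a k : ℝ) : EReal)) atTop (𝓝 S)

end Fock

/-! Put `s = π|z - w|²`. This function carries area to Lebesgue measure on the half-line, and the
squared modulus of the `k`-th normalized monomial centred at `w`, times the Gaussian weight, becomes
the Poisson weight `p_k(s) = s^k e^{-s} / k!`. Up to null sets a circularly symmetric set is `{s ∈
A}` with `|A| = |Ω| = m`. Averaging over rotations shows that its Toeplitz operator is diagonal in
these monomials, with eigenvalues `∫_A p_k`. For the disc, `A = (0, m)` and these are already
decreasing in `k`.

The sum of the `n` largest eigenvalues of `T_Ω` is `∫_A ∑_{k ∈ J} p_k` for some `J` with `n`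
elements, so majorization by the disc is a joint rearrangement in `A` and `J`
(`setIntegral_poissonSum_le`). With `f = ∑_{k < n} p_k`, which is strictly decreasing, and `t =
f(m)`, the integral over `A` is at most `t m + ∫ (∑_J p_k - t)₊`, and the disc attains this bound
when `J = {0, …, n-1}`. It remains to see that `∫ (∑_J p_k - t)₊` is largest for the initial block
of indices (`excess_poissonSum_le`).

For that, the indices of `J` lying above a filled initial block are moved down by one, repeatedly
(`excess_shift`). Since `p_k' = p_{k-1} - p_k`, the change caused by such a move is a derivative,
and its integral over a superlevel set can be computed.

Both eigenvalue sequences have total `m`, because `∑ p_k = 1`. A Karamata argument by supporting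
lines and summation by parts then compares the series (`add_sum_majorizationGain_le`). If every
partial sum is strictly smaller, equality of finite sums makes `Φ` affine
(`exists_affine_of_sum_eq`). Otherwise some partial sum agrees with that of the disc, and the
equality case of the rearrangement gives `A = (0, m)`. -/

namespace Fock

open scoped ComplexConjugate

/-! ### Poisson weights -/

/-- The Poisson weight `s ^ k e^{-s} / k!`. -/
noncomputable def poissonWeight (k : ℕ) (s : ℝ) : ℝ := s ^ k * Real.exp (-s) / k.factorial

/-- The Poisson weight of index `k - 1`, which is zero for `k = 0`. -/
noncomputable def poissonWeightPred : ℕ → ℝ → ℝ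
  | 0, _ => 0
  | k + 1, s => poissonWeight k s

/-- The sum of the Poisson weights over a finite set of indices. -/
noncomputable def poissonSum (J : Finset ℕ) (s : ℝ) : ℝ := ∑ k ∈ J, poissonWeight k s

lemma hasDerivAt_poissonWeight (k : ℕ) (s : ℝ) :
    HasDerivAt (poissonWeight k) (poissonWeightPred k s - poissonWeight k s) s := by
  have h1 : HasDerivAt (fun s : ℝ => Real.exp (-s)) (-Real.exp (-s)) s := by
    simpa using (hasDerivAt_neg s).exp
  have h := ((hasDerivAt_pow k s).mul h1).div_const (k.factorial : ℝ)
  refine h.congr_deriv ?_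
  cases k with
  | zero => simp [poissonWeight, poissonWeightPred]
  | succ k =>
    simp only [poissonWeight, poissonWeightPred, Nat.factorial_succ, Nat.cast_mul,
      Nat.add_sub_cancel]
    have : (k.factorial : ℝ) ≠ 0 := by positivity
    have : ((k + 1 : ℕ) : ℝ) ≠ 0 := by positivity
    field_simp
    ring

lemma continuous_poissonWeight (k : ℕ) : Continuous (poissonWeight k) := by
  unfold poissonWeight; fun_prop

lemma continuous_poissonWeightPred (k : ℕ) : Continuous (poissonWeightPred k) := by
  cases k with
  | zero => exact continuous_const
  | succ k => exact continuous_poissonWeight k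

lemma continuous_poissonSum (J : Finset ℕ) : Continuous (poissonSum J) :=
  continuous_finsetSum _ fun k _ => continuous_poissonWeight k

lemma poissonWeight_pos (k : ℕ) {s : ℝ} (hs : 0 < s) : 0 < poissonWeight k s := by
  unfold poissonWeight; positivity

lemma poissonWeight_nonneg (k : ℕ) {s : ℝ} (hs : 0 ≤ s) : 0 ≤ poissonWeight k s := by
  unfold poissonWeight; positivity

lemma poissonWeightPred_nonneg (k : ℕ) {s : ℝ} (hs : 0 ≤ s) : 0 ≤ poissonWeightPred k s := by
  cases k with
  | zero => exact le_rfl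
  | succ k => exact poissonWeight_nonneg k hs

lemma poissonSum_nonneg (J : Finset ℕ) {s : ℝ} (hs : 0 ≤ s) : 0 ≤ poissonSum J s :=
  Finset.sum_nonneg fun k _ => poissonWeight_nonneg k hs

lemma integrableOn_poissonWeight (k : ℕ) : IntegrableOn (poissonWeight k) (Set.Ioi 0) := by
  have h := Real.GammaIntegral_convergent (s := k + 1) (by positivity)
  refine IntegrableOn.congr_fun (h.div_const (k.factorial : ℝ)) (fun s hs => ?_) measurableSet_Ioi
  simp [poissonWeight, mul_comm]

lemma integral_poissonWeight (k : ℕ) : ∫ s in Set.Ioi 0, poissonWeight k s = 1 := by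
  have h := Real.Gamma_eq_integral (s := k + 1) (by positivity)
  rw [Real.Gamma_nat_eq_factorial] at h
  have h2 : ∫ s in Set.Ioi (0 : ℝ), poissonWeight k s
      = (∫ s in Set.Ioi (0 : ℝ), Real.exp (-s) * s ^ ((k : ℝ) + 1 - 1)) / k.factorial := by
    rw [← integral_div]
    refine setIntegral_congr_fun measurableSet_Ioi (fun s hs => ?_)
    simp [poissonWeight, mul_comm]
  rw [h2, ← h, div_self (by positivity)]

lemma integrableOn_poissonWeightPred (k : ℕ) :
    IntegrableOn (poissonWeightPred k) (Set.Ioi 0) := by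
  cases k with
  | zero => exact integrableOn_zero
  | succ k => exact integrableOn_poissonWeight k

lemma integrableOn_poissonSum (J : Finset ℕ) : IntegrableOn (poissonSum J) (Set.Ioi 0) :=
  integrable_finsetSum _ fun k _ => integrableOn_poissonWeight k

lemma tendsto_poissonWeight (k : ℕ) : Tendsto (poissonWeight k) atTop (𝓝 0) := by
  have h := (Real.tendsto_pow_mul_exp_neg_atTop_nhds_zero k).div_const (k.factorial : ℝ)
  rwa [zero_div] at h

lemma tendsto_poissonSum (J : Finset ℕ) : Tendsto (poissonSum J) atTop (𝓝 0) := by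
  have := tendsto_finsetSum J fun k _ => tendsto_poissonWeight k
  rwa [Finset.sum_const_zero] at this

lemma poissonWeight_zero_right (k : ℕ) : poissonWeight k 0 = if k = 0 then 1 else 0 := by
  cases k <;> simp [poissonWeight]

lemma hasSum_poissonWeight (s : ℝ) : HasSum (fun k => poissonWeight k s) 1 := by
  have h := NormedSpace.expSeries_div_hasSum_exp (𝔸 := ℝ) s
  have h2 := h.mul_right (Real.exp (-s))
  rw [← Real.exp_eq_exp_ℝ, ← Real.exp_add, add_neg_cancel, Real.exp_zero] at h2
  refine h2.congr_fun fun k => ?_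
  simp only [poissonWeight]
  ring

/-- The differences `p_{k-1} - p_k` telescope over an initial block; for `l = 0` the predecessor
weight is zero by convention. This makes initial blocks decreasing. -/
lemma hasDerivAt_poissonSum_range (l : ℕ) (s : ℝ) :
    HasDerivAt (poissonSum (Finset.range l)) (-poissonWeightPred l s) s := by
  induction l with
  | zero =>
    refine (hasDerivAt_const s (0 : ℝ)).congr_of_eventuallyEq ?_ |>.congr_deriv ?_
    · exact Eventually.of_forall fun x => by simp [poissonSum]
    · simp [poissonWeightPred]
  | succ l ih =>
    have h := ih.add (hasDerivAt_poissonWeight l s)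
    have e : poissonSum (Finset.range (l + 1)) = poissonSum (Finset.range l) + poissonWeight l := by
      ext x; simp [poissonSum, Finset.sum_range_succ]
    rw [e]
    refine h.congr_deriv ?_
    change _ = -poissonWeight l s
    ring

/-- Lowering every index by one changes the sum by exactly its derivative. The index `0` is excluded
since truncated predecessor would send it to itself. -/
lemma hasDerivAt_poissonSum (U : Finset ℕ) (hU : 0 ∉ U) (s : ℝ) :
    HasDerivAt (poissonSum U) (poissonSum (U.image Nat.pred) s - poissonSum U s) s := by
  have h := HasDerivAt.fun_sum (u := U) fun k _ => hasDerivAt_poissonWeight k s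
  refine h.congr_deriv ?_
  rw [Finset.sum_sub_distrib, poissonSum, poissonSum, Finset.sum_image]
  · congr 1
    refine Finset.sum_congr rfl fun k hk => ?_
    cases k with
    | zero => exact absurd hk hU
    | succ k => rfl
  · intro a ha b hb hab
    have h1 : a ≠ 0 := fun h => hU (h ▸ ha)
    have h2 : b ≠ 0 := fun h => hU (h ▸ hb)
    simp only [Nat.pred_eq_sub_one] at hab
    omega

/-! ### Rearrangement of indices: integrals of positive parts -/

/-- The derivative from the right of a positive part. -/
lemma hasDerivWithinAt_posPart {f : ℝ → ℝ} {f' t x : ℝ} (hf : HasDerivAt f f' x) :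
    HasDerivWithinAt (fun s => max (f s - t) 0)
      (if t < f x ∨ (f x = t ∧ 0 < f') then f' else 0) (Set.Ioi x) x := by
  rcases lt_trichotomy t (f x) with h | h | h
  · rw [if_pos (Or.inl h)]
    refine ((hf.sub_const t).congr_of_eventuallyEq ?_).hasDerivWithinAt
    filter_upwards [hf.continuousAt.eventually (lt_mem_nhds h)] with y hy
    exact max_eq_left (by linarith)
  · have e : (if t < f x ∨ (f x = t ∧ 0 < f') then f' else 0) = max f' 0 := by
      by_cases h0 : 0 < f'
      · rw [if_pos (Or.inr ⟨h.symm, h0⟩), max_eq_left h0.le]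
      · rw [if_neg (by rintro (h1 | h1); exacts [h1.ne h, h0 h1.2]), max_eq_right (not_lt.1 h0)]
    rw [e, hasDerivWithinAt_iff_tendsto_slope' (by simp)]
    have h1 := (hasDerivWithinAt_iff_tendsto_slope' (by simp)).1
      (hf.hasDerivWithinAt (s := Set.Ioi x))
    refine (h1.max (tendsto_const_nhds (x := (0 : ℝ)))).congr' ?_
    filter_upwards [self_mem_nhdsWithin] with y hy
    have hy' : 0 < (y - x)⁻¹ := inv_pos.2 (sub_pos.2 hy)
    simp only [slope, vsub_eq_sub, smul_eq_mul]
    rw [h, sub_self, max_self, sub_zero, mul_max_of_nonneg _ _ hy'.le, mul_zero]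
  · rw [if_neg (by rintro (h1 | h1); exacts [absurd h1 h.not_gt, absurd h1.1 h.ne])]
    refine ((hasDerivAt_const x (0 : ℝ)).congr_of_eventuallyEq ?_).hasDerivWithinAt
    filter_upwards [hf.continuousAt.eventually (gt_mem_nhds h)] with y hy
    exact max_eq_right (by linarith)

/-- The set where `f > t`, enlarged by the points at which `f` crosses `t` upwards. -/
def superlevel (f f' : ℝ → ℝ) (t : ℝ) : Set ℝ := {s | t < f s ∨ (f s = t ∧ 0 < f' s)}

lemma measurableSet_superlevel {f f' : ℝ → ℝ} (hf : Continuous f) (hf' : Continuous f') (t : ℝ) :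
    MeasurableSet (superlevel f f' t) :=
  (measurableSet_lt measurable_const hf.measurable).union
    ((measurableSet_eq_fun hf.measurable measurable_const).inter
      (measurableSet_lt measurable_const hf'.measurable))

/-- The integrand is, at every point, the right derivative of `(f - t)₊`. Since `f` tends to `0 <
t`, the superlevel set is bounded, and the fundamental theorem of calculus leaves only the boundary
term at `0`. -/
lemma integral_superlevel_deriv {f f' : ℝ → ℝ} (hf : ∀ s, HasDerivAt f (f' s) s)
    (hf' : Continuous f') (hlim : Tendsto f atTop (𝓝 0)) {t : ℝ} (ht : 0 < t) :
    ∫ s in Set.Ioi 0, (superlevel f f' t).indicator f' s = -max (f 0 - t) 0 := by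
  have hc : Continuous f := continuous_iff_continuousAt.2 fun s => (hf s).continuousAt
  have hm := measurableSet_superlevel hc hf' t
  obtain ⟨R, hR⟩ := eventually_atTop.1 (hlim.eventually (gt_mem_nhds ht))
  set M := max R 0
  have hM0 : 0 ≤ M := le_max_right _ _
  have hM : ∀ s, M ≤ s → f s < t := fun s hs => hR s ((le_max_left _ _).trans hs)
  have hint : IntervalIntegrable ((superlevel f f' t).indicator f') volume 0 M := by
    rw [intervalIntegrable_iff_integrableOn_Ioc_of_le hM0]
    exact ((hf'.continuousOn.integrableOn_Icc).mono_set Set.Ioc_subset_Icc_self).indicator hm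
  have h := intervalIntegral.integral_eq_sub_of_hasDeriv_right_of_le hM0
    (f := fun s => max (f s - t) 0) (f' := (superlevel f f' t).indicator f')
    (by fun_prop) (fun x _ => by
      have := hasDerivWithinAt_posPart (t := t) (hf x)
      classical
      refine this.congr_deriv ?_
      rw [Set.indicator_apply]
      exact if_congr Iff.rfl rfl rfl) hint
  rw [intervalIntegral.integral_of_le hM0] at h
  rw [← Set.Ioc_union_Ioi_eq_Ioi hM0, setIntegral_union Set.Ioc_disjoint_Ioi_same measurableSet_Ioi,
    h, setIntegral_congr_fun (g := fun _ => (0 : ℝ)) measurableSet_Ioi]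
  · rw [max_eq_right (a := f M - t) (by linarith [hM M le_rfl])]
    simp
  · intro s hs
    have := hM s (le_of_lt hs)
    refine Set.indicator_of_notMem ?_ _
    rintro (h1 | h1)
    · linarith
    · linarith [h1.1]
  · exact (intervalIntegrable_iff_integrableOn_Ioc_of_le hM0).1 hint
  · refine integrableOn_zero.congr_fun (fun s hs => ?_) measurableSet_Ioi
    have := hM s (le_of_lt hs)
    refine (Set.indicator_of_notMem ?_ _).symm
    rintro (h1 | h1)
    · linarith
    · linarith [h1.1]

/-- The integral of the positive part of `f - t` over the half-line. -/
noncomputable def excess (t : ℝ) (f : ℝ → ℝ) : ℝ := ∫ s in Set.Ioi 0, max (f s - t) 0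

lemma integrableOn_posPart {f : ℝ → ℝ} (hc : Continuous f) (hf : IntegrableOn f (Set.Ioi 0))
    {t : ℝ} (ht : 0 < t) : IntegrableOn (fun s => max (f s - t) 0) (Set.Ioi 0) := by
  refine Integrable.mono hf (by fun_prop) (ae_of_all _ fun s => ?_)
  rw [Real.norm_eq_abs, Real.norm_eq_abs, abs_of_nonneg (le_max_right _ _)]
  exact max_le (by linarith [le_abs_self (f s)]) (abs_nonneg _)

/-- A continuous function that is nonnegative on the half-line and positive somewhere in it has a
positive integral. -/
lemma setIntegral_Ioi_pos_of_pos_on {f : ℝ → ℝ} {a b : ℝ} (ha : 0 ≤ a) (hab : a < b)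
    (hint : IntegrableOn f (Set.Ioi 0)) (h0 : ∀ s ∈ Set.Ioi (0 : ℝ), 0 ≤ f s)
    (hpos : ∀ s ∈ Set.Ioo a b, 0 < f s) : 0 < ∫ s in Set.Ioi 0, f s := by
  rw [setIntegral_pos_iff_support_of_nonneg_ae _ hint]
  · refine lt_of_lt_of_le ?_ (measure_mono (s := Set.Ioo a b) fun s hs => ?_)
    · simpa using hab
    · exact ⟨(hpos s hs).ne', lt_of_le_of_lt ha hs.1⟩
  · filter_upwards [ae_restrict_mem measurableSet_Ioi] with s hs using h0 s hs

lemma poissonSum_range_lt_one {l : ℕ} {s : ℝ} (hs : 0 < s) :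
    poissonSum (Finset.range l) s < 1 := by
  have h := hasSum_poissonWeight s
  have h1 := sum_le_hasSum (Finset.range (l + 1)) (fun k _ => poissonWeight_nonneg k hs.le) h
  rw [Finset.sum_range_succ] at h1
  have h2 := poissonWeight_pos l hs
  simp only [poissonSum]
  linarith

lemma poissonSum_range_zero {l : ℕ} (hl : l ≠ 0) : poissonSum (Finset.range l) 0 = 1 := by
  simp [poissonSum, poissonWeight_zero_right, Nat.pos_of_ne_zero hl]

lemma poissonSum_zero_of_notMem {U : Finset ℕ} (hU : 0 ∉ U) : poissonSum U 0 = 0 := by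
  simp [poissonSum, poissonWeight_zero_right, hU]

lemma strictAntiOn_poissonSum_range {l : ℕ} (hl : l ≠ 0) :
    StrictAntiOn (poissonSum (Finset.range l)) (Set.Ici 0) := by
  refine strictAntiOn_of_deriv_neg (convex_Ici 0) (continuous_poissonSum _).continuousOn
    fun s hs => ?_
  rw [interior_Ici] at hs
  rw [(hasDerivAt_poissonSum_range l s).deriv, neg_lt_zero]
  obtain ⟨k, rfl⟩ := Nat.exists_eq_succ_of_ne_zero hl
  exact poissonWeight_pos k hs

/-- Let `q = -L'`, where `L` is the block below `l`, and let `u`, `v` be the sums before and after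
the shift, so that `u' = v - u`. Let `A`, `B` be the superlevel sets of `L + u` and of `L`. As `u(0)
= 0`, the derivatives of `L + u` over `A` and of `L` over `B` have the same integral, whence `∫_A (v
- u) = ∫_A q - ∫_B q`. This is nonnegative because `q ≥ 0` and `B ⊆ A` on the half-line. Finally `(L
+ v - t)₊ - (L + u - t)₊ ≥ 1_A (v - u)` pointwise. -/
lemma excess_shift {l : ℕ} {U : Finset ℕ} (hU : ∀ u ∈ U, l < u) {t : ℝ} (ht : 0 < t) :
    excess t (poissonSum (Finset.range l) + poissonSum U) ≤
      excess t (poissonSum (Finset.range l) + poissonSum (U.image Nat.pred)) ∧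
    (t < 1 → U.Nonempty → (l ≠ 0 ∨ 1 ∈ U) →
      excess t (poissonSum (Finset.range l) + poissonSum U) <
        excess t (poissonSum (Finset.range l) + poissonSum (U.image Nat.pred))) := by
  have hU0 : 0 ∉ U := fun h => by simpa using hU 0 h
  set L := poissonSum (Finset.range l) with hL
  set u := poissonSum U with hu
  set v := poissonSum (U.image Nat.pred) with hv
  have cL : Continuous L := continuous_poissonSum _
  have cu : Continuous u := continuous_poissonSum _
  have cv : Continuous v := continuous_poissonSum _
  have cq := continuous_poissonWeightPred l
  have iL : IntegrableOn L (Set.Ioi 0) := integrableOn_poissonSum _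
  have iu : IntegrableOn u (Set.Ioi 0) := integrableOn_poissonSum _
  have iv : IntegrableOn v (Set.Ioi 0) := integrableOn_poissonSum _
  have iq := integrableOn_poissonWeightPred l
  have q0 : ∀ s ∈ Set.Ioi (0 : ℝ), 0 ≤ poissonWeightPred l s := fun s hs =>
    poissonWeightPred_nonneg l (le_of_lt hs)
  have u0 : ∀ s ∈ Set.Ioi (0 : ℝ), 0 ≤ u s := fun s hs => poissonSum_nonneg U (le_of_lt hs)
  have dL := hasDerivAt_poissonSum_range l
  have du := hasDerivAt_poissonSum U hU0
  set f' : ℝ → ℝ := fun s => -poissonWeightPred l s + (v s - u s) with hf'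
  have df : ∀ s, HasDerivAt (L + u) (f' s) s := fun s => (dL s).add (du s)
  have cf' : Continuous f' := by fun_prop
  set A := superlevel (L + u) f' t
  set B := superlevel L (fun s => -poissonWeightPred l s) t
  have mA : MeasurableSet A := measurableSet_superlevel (cL.add cu) cf' t
  have mB : MeasurableSet B := measurableSet_superlevel cL cq.neg t
  have IA := integral_superlevel_deriv df cf'
    (by
      have := (tendsto_poissonSum (Finset.range l)).add (tendsto_poissonSum U)
      rwa [add_zero] at this) ht
  have IB := integral_superlevel_deriv dL cq.neg (tendsto_poissonSum _) ht
  have hf0 : (L + u) 0 = L 0 := by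
    rw [Pi.add_apply, hu, poissonSum_zero_of_notMem hU0, add_zero]
  rw [hf0] at IA
  -- the two nonnegative integrands whose integrals add up to the difference
  set g : ℝ → ℝ := fun s => max ((L + v) s - t) 0 - max ((L + u) s - t) 0
    - A.indicator (fun s => v s - u s) s with hg
  set h : ℝ → ℝ := fun s => A.indicator (poissonWeightPred l) s
    - B.indicator (poissonWeightPred l) s with hh
  have i1 := integrableOn_posPart (cL.add cv) (iL.add iv) ht
  have i2 := integrableOn_posPart (cL.add cu) (iL.add iu) ht
  have i3 : IntegrableOn (A.indicator fun s => v s - u s) (Set.Ioi 0) := (iv.sub iu).indicator mA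
  have i4 : IntegrableOn (A.indicator (poissonWeightPred l)) (Set.Ioi 0) := iq.indicator mA
  have i5 : IntegrableOn (B.indicator (poissonWeightPred l)) (Set.Ioi 0) := iq.indicator mB
  have ig : IntegrableOn g (Set.Ioi 0) := (i1.sub i2).sub i3
  have ih : IntegrableOn h (Set.Ioi 0) := i4.sub i5
  have key : excess t (L + v) - excess t (L + u)
      = (∫ s in Set.Ioi 0, g s) + ∫ s in Set.Ioi 0, h s := by
    have e1 : ∫ s in Set.Ioi 0, g s = excess t (L + v) - excess t (L + u)
        - ∫ s in Set.Ioi 0, A.indicator (fun s => v s - u s) s := by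
      have e0 := integral_sub i1 i2
      exact (integral_sub (i1.sub i2) i3).trans (congrArg (· - _) e0)
    have e2 : ∫ s in Set.Ioi 0, h s = (∫ s in Set.Ioi 0, A.indicator (poissonWeightPred l) s)
        - ∫ s in Set.Ioi 0, B.indicator (poissonWeightPred l) s := integral_sub i4 i5
    have e3 : ∫ s in Set.Ioi 0, A.indicator f' s
        = -(∫ s in Set.Ioi 0, A.indicator (poissonWeightPred l) s)
          + ∫ s in Set.Ioi 0, A.indicator (fun s => v s - u s) s := by
      rw [← integral_neg]
      refine Eq.trans ?_ (integral_add i4.neg i3)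
      refine integral_congr_ae (ae_of_all _ fun s => ?_)
      by_cases hs : s ∈ A <;> simp [hs, hf']
    have e4 : ∫ s in Set.Ioi 0, B.indicator (fun s => -poissonWeightPred l s) s
        = -∫ s in Set.Ioi 0, B.indicator (poissonWeightPred l) s := by
      rw [← integral_neg]
      refine integral_congr_ae (ae_of_all _ fun s => ?_)
      by_cases hs : s ∈ B <;> simp [hs]
    change ∫ s in Set.Ioi 0, A.indicator f' s = _ at IA
    change ∫ s in Set.Ioi 0, B.indicator (fun s => -poissonWeightPred l s) s = _ at IB
    linarith
  have g0 : ∀ s ∈ Set.Ioi (0 : ℝ), 0 ≤ g s := by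
    intro s hs
    simp only [hg, Pi.add_apply]
    by_cases hA : s ∈ A
    · have h1 : t ≤ L s + u s := hA.elim le_of_lt fun h => h.1.ge
      rw [Set.indicator_of_mem hA, max_eq_left (a := L s + u s - t) (by linarith)]
      linarith [le_max_left (L s + v s - t) 0]
    · have h1 : L s + u s ≤ t := not_lt.1 fun h => hA (Or.inl h)
      rw [Set.indicator_of_notMem hA, max_eq_right (a := L s + u s - t) (by linarith)]
      simp
  have h0 : ∀ s ∈ Set.Ioi (0 : ℝ), 0 ≤ h s := by
    intro s hs
    simp only [hh]
    by_cases hB : s ∈ B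
    · have h1 : t < L s ∨ poissonWeightPred l s < 0 := hB.imp id fun h => by simpa using h.2
      have h2 : t < L s := h1.resolve_right (not_lt.2 (q0 s hs))
      have hA : s ∈ A := Or.inl (by rw [Pi.add_apply]; linarith [u0 s hs])
      rw [Set.indicator_of_mem hA, Set.indicator_of_mem hB, sub_self]
    · rw [Set.indicator_of_notMem hB, sub_zero]
      exact Set.indicator_apply_nonneg fun _ => q0 s hs
  have Ig : 0 ≤ ∫ s in Set.Ioi 0, g s := setIntegral_nonneg measurableSet_Ioi g0
  have Ih : 0 ≤ ∫ s in Set.Ioi 0, h s := setIntegral_nonneg measurableSet_Ioi h0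
  refine ⟨by linarith, fun ht1 hne hor => ?_⟩
  -- Strictness. For `l = 0` the shift creates the index `0`, so near `s = 0` one has `u < t < v`
  -- and `g > 0`. For `l ≠ 0` the block `L` falls from `1` through the level `t` at some `s₀`; just
  -- after `s₀` one has `L < t < L + u`, a part of `A` outside `B` on which `q > 0`.
  by_cases hl : l = 0
  · have h1U : 1 ∈ U := hor.resolve_left (not_not.2 hl)
    have hv0 : 1 ≤ v 0 := by
      have : 0 ∈ U.image Nat.pred := Finset.mem_image.2 ⟨1, h1U, rfl⟩
      have h1 := Finset.single_le_sum (f := fun k => poissonWeight k 0)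
        (fun k _ => poissonWeight_nonneg k le_rfl) this
      simp only [poissonWeight_zero_right, if_true] at h1
      simpa only [hv, poissonSum, poissonWeight_zero_right] using h1
    have hL0 : ∀ s, L s = 0 := fun s => by simp [hL, hl, poissonSum]
    have hu0 : u 0 = 0 := poissonSum_zero_of_notMem hU0
    have ev : ∀ᶠ s in 𝓝 (0 : ℝ), u s < t ∧ t < v s :=
      (cu.continuousAt.eventually (gt_mem_nhds (show u 0 < t by rw [hu0]; exact ht))).and
        (cv.continuousAt.eventually (lt_mem_nhds (ht1.trans_le hv0)))
    obtain ⟨ε, hε, hball⟩ := Metric.eventually_nhds_iff.1 ev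
    have : 0 < ∫ s in Set.Ioi 0, g s := by
      refine setIntegral_Ioi_pos_of_pos_on le_rfl hε ig g0 fun s hs => ?_
      obtain ⟨h1, h2⟩ := hball (y := s) (by
        rw [Real.dist_eq, sub_zero, abs_of_pos hs.1]; exact hs.2)
      have hA : s ∉ A := by
        rintro (h3 | h3)
        · rw [Pi.add_apply, hL0] at h3; linarith
        · have h4 := h3.1
          rw [Pi.add_apply, hL0] at h4; linarith
      simp only [hg, Pi.add_apply, hL0, zero_add]
      rw [Set.indicator_of_notMem hA, max_eq_right (a := u s - t) (by linarith), sub_zero, sub_zero]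
      exact lt_max_of_lt_left (by linarith)
    linarith
  · have hL1 : L 0 = 1 := poissonSum_range_zero hl
    obtain ⟨R, hR⟩ := eventually_atTop.1
      ((tendsto_poissonSum (Finset.range l)).eventually (gt_mem_nhds ht))
    have hR0 := hR (max R 0) (le_max_left _ _)
    obtain ⟨s₀, hs₀, hs₀t⟩ := intermediate_value_Icc' (le_max_right R 0) cL.continuousOn
      (show t ∈ Set.Icc _ _ from ⟨hR0.le, by rw [hL1]; exact ht1.le⟩)
    have hs₀pos : 0 < s₀ := lt_of_le_of_ne hs₀.1 fun h => by
      rw [← h, hL1] at hs₀t; exact ht1.ne' hs₀t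
    have hupos : 0 < u s₀ := Finset.sum_pos (fun k _ => poissonWeight_pos k hs₀pos) hne
    have ev : ∀ᶠ s in 𝓝 s₀, t < (L + u) s := (cL.add cu).continuousAt.eventually
      (lt_mem_nhds (by rw [Pi.add_apply, hs₀t]; linarith))
    obtain ⟨ε, hε, hball⟩ := Metric.eventually_nhds_iff.1 ev
    have : 0 < ∫ s in Set.Ioi 0, h s := by
      refine setIntegral_Ioi_pos_of_pos_on hs₀.1 (lt_add_of_pos_right s₀ hε) ih h0 fun s hs => ?_
      have hspos : 0 < s := hs₀pos.trans hs.1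
      have hA : s ∈ A := Or.inl (hball (y := s) (by
        rw [Real.dist_eq, abs_of_pos (by linarith [hs.1])]; linarith [hs.2]))
      have hlt : L s < t := by
        rw [← hs₀t]
        exact strictAntiOn_poissonSum_range hl hs₀pos.le hspos.le hs.1
      have hB : s ∉ B := by
        rintro (h3 | h3)
        · linarith
        · linarith [h3.1]
      simp only [hh]
      rw [Set.indicator_of_mem hA, Set.indicator_of_notMem hB, sub_zero]
      obtain ⟨k, rfl⟩ := Nat.exists_eq_succ_of_ne_zero hl
      exact poissonWeight_pos k hspos
    linarith

lemma sum_pred_add_one_lt {U : Finset ℕ} (h0 : 0 ∉ U) (hne : U.Nonempty) :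
    ∑ u ∈ U.image Nat.pred, (u + 1) < ∑ u ∈ U, (u + 1) := by
  have hinj : Set.InjOn Nat.pred U := by
    intro a ha b hb hab
    have h1 : a ≠ 0 := fun h => h0 (h ▸ ha)
    have h2 : b ≠ 0 := fun h => h0 (h ▸ hb)
    simp only [Nat.pred_eq_sub_one] at hab
    omega
  rw [Finset.sum_image hinj]
  refine Finset.sum_lt_sum_of_nonempty hne fun u hu => ?_
  have : u ≠ 0 := fun h => h0 (h ▸ hu)
  simp only [Nat.pred_eq_sub_one]
  omega

/-- Either `l ∈ U` and it joins the filled block, or all of `U` lies above `l` and can be shifted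
down. Both moves lower `∑ (u + 1)`; the summand `+ 1` makes this true also when the absorbed index
is `0`. -/
theorem excess_add_le {t : ℝ} (ht : 0 < t) (N : ℕ) : ∀ (l : ℕ) (U : Finset ℕ),
    (∀ u ∈ U, l ≤ u) → ∑ u ∈ U, (u + 1) = N →
    excess t (poissonSum (Finset.range l) + poissonSum U) ≤
      excess t (poissonSum (Finset.range (l + U.card))) ∧
    (t < 1 → U ≠ Finset.Ico l (l + U.card) →
      excess t (poissonSum (Finset.range l) + poissonSum U) <
        excess t (poissonSum (Finset.range (l + U.card)))) := by
  induction N using Nat.strong_induction_on with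
  | _ N ih =>
  intro l U hU hN
  rcases U.eq_empty_or_nonempty with rfl | hne
  · have : poissonSum (Finset.range l) + poissonSum ∅ = poissonSum (Finset.range l) := by
      ext; simp [poissonSum]
    simp [this]
  by_cases hl : l ∈ U
  · set V := U.erase l with hV
    have hUV : U = insert l V := (Finset.insert_erase hl).symm
    have hlV : l ∉ V := Finset.notMem_erase l U
    have hcard : U.card = V.card + 1 := by rw [hUV, Finset.card_insert_of_notMem hlV]
    have hsum : poissonSum (Finset.range l) + poissonSum U
        = poissonSum (Finset.range (l + 1)) + poissonSum V := by
      ext s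
      simp only [Pi.add_apply, poissonSum]
      rw [hUV, Finset.sum_insert hlV, Finset.sum_range_succ, add_assoc]
    have hlt : ∑ u ∈ V, (u + 1) < N := by
      rw [← hN, hUV, Finset.sum_insert hlV]; omega
    have hV' : ∀ u ∈ V, l + 1 ≤ u := fun u hu =>
      Nat.succ_le_of_lt (lt_of_le_of_ne (hU u (Finset.mem_of_mem_erase hu))
        (Finset.ne_of_mem_erase hu).symm)
    obtain ⟨h1, h2⟩ := ih _ hlt (l + 1) V hV' rfl
    rw [hsum, show l + U.card = l + 1 + V.card by omega]
    refine ⟨h1, fun ht1 hne' => h2 ht1 fun hc => hne' ?_⟩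
    ext x
    rw [hUV, Finset.mem_insert, hc, Finset.mem_Ico, Finset.mem_Ico, ← hc]
    omega
  · have hU' : ∀ u ∈ U, l < u := fun u hu => lt_of_le_of_ne (hU u hu) fun h => hl (h ▸ hu)
    have h0 : 0 ∉ U := fun h => by simpa using hU' 0 h
    have hinj : Set.InjOn Nat.pred U := by
      intro a ha b hb hab
      have h1 := hU' a ha
      have h2 := hU' b hb
      simp only [Nat.pred_eq_sub_one] at hab
      omega
    have hcard : (U.image Nat.pred).card = U.card := Finset.card_image_of_injOn hinj
    obtain ⟨h1, h2⟩ := ih _ (hN ▸ sum_pred_add_one_lt h0 hne) l (U.image Nat.pred) (by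
      intro u hu
      obtain ⟨v, hv, rfl⟩ := Finset.mem_image.1 hu
      have := hU' v hv
      simp only [Nat.pred_eq_sub_one]
      omega) rfl
    rw [hcard] at h1 h2
    obtain ⟨h3, h4⟩ := excess_shift hU' ht
    refine ⟨h3.trans h1, fun ht1 _ => ?_⟩
    -- In the one case where the shift need not be strict, the shifted set still misses `0`, so it
    -- is not an initial block and strictness comes from the induction hypothesis.
    by_cases hor : l ≠ 0 ∨ 1 ∈ U
    · exact (h4 ht1 hne hor).trans_le h1
    · push Not at hor
      refine h3.trans_lt (h2 ht1 fun hc => ?_)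
      have hmem : 0 ∈ U.image Nat.pred := by
        rw [hc, hor.1, Finset.mem_Ico]
        have := hne.card_pos
        omega
      obtain ⟨v, hv, hv0⟩ := Finset.mem_image.1 hmem
      have hv1 : v = 1 := by
        have h5 : v ≠ 0 := fun h => h0 (h ▸ hv)
        simp only [Nat.pred_eq_sub_one] at hv0
        omega
      exact hor.2 (hv1 ▸ hv)

theorem excess_poissonSum_le {t : ℝ} (ht : 0 < t) (J : Finset ℕ) :
    excess t (poissonSum J) ≤ excess t (poissonSum (Finset.range J.card)) ∧
    (t < 1 → J ≠ Finset.range J.card →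
      excess t (poissonSum J) < excess t (poissonSum (Finset.range J.card))) := by
  have h := excess_add_le ht _ 0 J (fun _ _ => Nat.zero_le _) rfl
  have e : poissonSum (Finset.range 0) + poissonSum J = poissonSum J := by
    ext; simp [poissonSum]
  rwa [e, zero_add, ← Finset.range_eq_Ico] at h

/-- Among the sets of measure `m` and the sets of `n` indices, the integral of a sum of Poisson
weights is largest for the interval `(0, m)` and the first `n` indices. -/
theorem setIntegral_poissonSum_le {A : Set ℝ} (hA : MeasurableSet A) (hA0 : A ⊆ Set.Ioi 0)
    {m : ℝ} (hm : 0 < m) (hAm : volume A = ENNReal.ofReal m) {J : Finset ℕ} (hJ : J.Nonempty) :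
    ∫ s in A, poissonSum J s ≤ ∫ s in Set.Ioo 0 m, poissonSum (Finset.range J.card) s ∧
    (∫ s in A, poissonSum J s = ∫ s in Set.Ioo 0 m, poissonSum (Finset.range J.card) s →
      A =ᵐ[volume] Set.Ioo 0 m) := by
  set n := J.card with hn
  have hn0 : n ≠ 0 := hJ.card_pos.ne'
  set f := poissonSum (Finset.range n) with hf
  -- At this level the superlevel set of the decreasing function `f` is exactly `(0, m)`.
  set t := f m with ht
  have ht0 : 0 < t := Finset.sum_pos (fun k _ => poissonWeight_pos k hm)
    (Finset.nonempty_range_iff.2 hn0)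
  have ht1 : t < 1 := poissonSum_range_lt_one hm
  have hanti := strictAntiOn_poissonSum_range hn0
  -- the positive part dominates
  have dom : ∀ (K : Finset ℕ), 0 ≤ (∫ s in Set.Ioi 0, (max (poissonSum K s - t) 0
        - A.indicator (fun s => poissonSum K s - t) s)) ∧
      (∫ s in Set.Ioi 0, (max (poissonSum K s - t) 0
        - A.indicator (fun s => poissonSum K s - t) s))
      = excess t (poissonSum K) - ((∫ s in A, poissonSum K s) - t * m) ∧
      IntegrableOn (fun s => max (poissonSum K s - t) 0
        - A.indicator (fun s => poissonSum K s - t) s) (Set.Ioi 0) := by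
    intro K
    have i1 := integrableOn_posPart (continuous_poissonSum K) (integrableOn_poissonSum K) ht0
    have i2 : IntegrableOn (fun s => poissonSum K s - t) A :=
      ((integrableOn_poissonSum K).mono_set hA0).sub
        (integrableOn_const (by rw [hAm]; exact ENNReal.ofReal_ne_top))
    have i3 : IntegrableOn (A.indicator (fun s => poissonSum K s - t)) (Set.Ioi 0) :=
      ((integrable_indicator_iff hA).2 i2).integrableOn
    refine ⟨integral_nonneg fun s => ?_, ?_, i1.sub i3⟩
    · by_cases hs : s ∈ A <;> simp [hs]
    · rw [integral_sub i1 i3, setIntegral_indicator hA, Set.inter_eq_right.2 hA0, integral_sub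
        ((integrableOn_poissonSum K).mono_set hA0)
        (integrableOn_const (by rw [hAm]; exact ENNReal.ofReal_ne_top)), setIntegral_const,
        measureReal_def, hAm, ENNReal.toReal_ofReal hm.le, smul_eq_mul, mul_comm m t]
      rfl
  have hball : excess t f = (∫ s in Set.Ioo 0 m, f s) - t * m := by
    have i2 : IntegrableOn f (Set.Ioo 0 m) :=
      (integrableOn_poissonSum _).mono_set Set.Ioo_subset_Ioi_self
    have e : excess t f = ∫ s in Set.Ioi 0, (Set.Ioo 0 m).indicator (fun s => f s - t) s := by
      refine setIntegral_congr_fun measurableSet_Ioi fun s hs => ?_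
      by_cases hsm : s < m
      · have h1 : m ∈ Set.Ici (0 : ℝ) := hm.le
        have h2 := hanti (show s ∈ Set.Ici 0 from Set.Ioi_subset_Ici_self hs) h1 hsm
        have hmem : s ∈ Set.Ioo 0 m := ⟨hs, hsm⟩
        rw [Set.indicator_of_mem hmem]
        exact max_eq_left (sub_pos.2 h2).le
      · have h1 : s ∈ Set.Ici (0 : ℝ) := Set.Ioi_subset_Ici_self hs
        have h2 := hanti.antitoneOn hm.le h1 (not_lt.1 hsm)
        have hmem : s ∉ Set.Ioo 0 m := fun h => hsm h.2
        rw [Set.indicator_of_notMem hmem]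
        exact max_eq_right (sub_nonpos.2 h2)
    rw [e, setIntegral_indicator measurableSet_Ioo,
      Set.inter_eq_right.2 Set.Ioo_subset_Ioi_self, integral_sub i2
        (integrableOn_const (by simp)), setIntegral_const,
      measureReal_def, Real.volume_Ioo, sub_zero, ENNReal.toReal_ofReal hm.le, smul_eq_mul,
      mul_comm m t]
  obtain ⟨d1, d2, d3⟩ := dom J
  obtain ⟨e1, e2⟩ := excess_poissonSum_le ht0 J
  refine ⟨by linarith, fun heq => ?_⟩
  -- Equality must hold in both inequalities of the chain: the comparison of excesses forces `J` to
  -- be the initial block, and then `(f - t)₊ = 1_A (f - t)` almost everywhere. Since `f - t`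
  -- vanishes on the half-line only at `m`, this identifies `A`.
  have hJn : J = Finset.range n := by
    by_contra hne
    have := e2 ht1 hne
    linarith
  have hz : ∫ s in Set.Ioi 0, (max (poissonSum J s - t) 0
      - A.indicator (fun s => poissonSum J s - t) s) = 0 := by
    refine le_antisymm ?_ d1
    linarith
  rw [integral_eq_zero_iff_of_nonneg_ae (ae_of_all _ fun s => by
    by_cases hs : s ∈ A <;> simp [hs]) d3] at hz
  rw [EventuallyEq, ae_restrict_iff' measurableSet_Ioi] at hz
  have hmne : ∀ᵐ s : ℝ, s ≠ m := by
    rw [ae_iff]; simp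
  filter_upwards [hz, hmne] with s hs hsm
  have h0 : s ∈ A → 0 < s := fun h => hA0 h
  refine propext ⟨fun (h : s ∈ A) => ?_, fun h => ?_⟩
  · have h1 := hs (h0 h)
    rw [Set.indicator_of_mem h, Pi.zero_apply, sub_eq_zero, hJn] at h1
    refine ⟨h0 h, lt_of_le_of_ne (not_lt.1 fun hlt => ?_) hsm⟩
    have h2 := hanti hm.le (h0 h).le hlt
    have h3 := le_max_right (poissonSum (Finset.range n) s - t) 0
    rw [h1] at h3
    linarith
  · by_contra hc
    have h1 := hs h.1
    rw [Set.indicator_of_notMem hc, Pi.zero_apply, sub_zero, hJn] at h1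
    have h2 := hanti (le_of_lt h.1) hm.le h.2
    have h3 := le_max_left (poissonSum (Finset.range n) s - t) 0
    rw [h1] at h3
    linarith

/-! ### Majorization and series of a convex function -/

/-- The right derivative of a convex function provides supporting lines. -/
lemma convexOn_add_rightDeriv_mul_le {S : Set ℝ} {f : ℝ → ℝ} (hf : ConvexOn ℝ S f) {x y : ℝ}
    (hx : x ∈ interior S) (hy : y ∈ S) :
    f x + derivWithin f (Set.Ioi x) x * (y - x) ≤ f y := by
  rcases lt_trichotomy x y with h | rfl | h
  · have h1 := hf.rightDeriv_le_slope_of_mem_interior hx hy h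
    rw [slope_def_field, le_div_iff₀ (sub_pos.2 h)] at h1
    linarith
  · simp
  · have h1 := (hf.slope_le_leftDeriv_of_mem_interior hy hx h).trans
      (hf.leftDeriv_le_rightDeriv_of_mem_interior hx)
    rw [slope_def_field, div_le_iff₀ (sub_pos.2 h)] at h1
    linarith

/-- The sublevel set `{Φ ≤ 0}` is an interval. If `Φ` takes negative values arbitrarily close to
`0`, this interval contains some `(0, y)`. The constant sign makes the partial sums of `Φ` along a
null sequence eventually monotone. -/
lemma convexOn_sign_near_zero {Φ : ℝ → ℝ} (hΦ : ConvexOn ℝ (Set.Ioo 0 1) Φ) :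
    ∃ δ > 0, (∀ x ∈ Set.Ioo 0 δ, Φ x ≤ 0) ∨ (∀ x ∈ Set.Ioo 0 δ, 0 ≤ Φ x) := by
  by_cases h : ∃ δ ∈ Set.Ioo (0 : ℝ) 1, ∀ x ∈ Set.Ioo 0 δ, 0 ≤ Φ x
  · obtain ⟨δ, hδ, h⟩ := h
    exact ⟨δ, hδ.1, Or.inr h⟩
  · push Not at h
    obtain ⟨y, hy, hy0⟩ := h (1 / 2) (by norm_num)
    refine ⟨y, hy.1, Or.inl fun x hx => ?_⟩
    have hy1 : y < 1 := hy.2.trans (by norm_num)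
    obtain ⟨z, hz, hz0⟩ := h x ⟨hx.1, hx.2.trans hy1⟩
    have hc := (hΦ.convex_le 0).ordConnected
    exact (hc.out (x := z) ⟨⟨hz.1, hz.2.trans (hx.2.trans hy1)⟩, hz0.le⟩
      (y := y) ⟨⟨hy.1, hy1⟩, hy0.le⟩ ⟨hz.2.le, hx.2.le⟩).2

lemma exists_tendsto_sum_of_convexOn {Φ : ℝ → ℝ} (hΦ : ConvexOn ℝ (Set.Ioo 0 1) Φ) {a : ℕ → ℝ}
    (ha : ∀ n, a n ∈ Set.Ioo (0 : ℝ) 1) (hlim : Tendsto a atTop (𝓝 0)) :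
    ∃ S : EReal, Tendsto (fun N : ℕ => ((∑ i ∈ Finset.range N, Φ (a i) : ℝ) : EReal)) atTop
      (𝓝 S) := by
  obtain ⟨δ, hδ, h⟩ := convexOn_sign_near_zero hΦ
  obtain ⟨N₀, hN₀⟩ := eventually_atTop.1 (hlim.eventually (gt_mem_nhds hδ))
  rcases h with h | h
  · refine ⟨_, (tendsto_add_atTop_iff_nat N₀).1 (tendsto_atTop_iInf (antitone_nat_of_succ_le
      fun n => ?_))⟩
    rw [EReal.coe_le_coe_iff, show n + 1 + N₀ = n + N₀ + 1 by ring, Finset.sum_range_succ]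
    linarith [h (a (n + N₀)) ⟨(ha _).1, hN₀ _ (by omega)⟩]
  · refine ⟨_, (tendsto_add_atTop_iff_nat N₀).1 (tendsto_atTop_iSup (monotone_nat_of_le_succ
      fun n => ?_))⟩
    rw [EReal.coe_le_coe_iff, show n + 1 + N₀ = n + N₀ + 1 by ring, Finset.sum_range_succ]
    linarith [h (a (n + N₀)) ⟨(ha _).1, hN₀ _ (by omega)⟩]

/-- If a series does not diverge to `+∞`, its terms are not bounded below by a positive number. -/
lemma frequently_le_of_tendsto_sum {x : ℕ → ℝ} {S : EReal} (hS : S ≠ ⊤)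
    (h : Tendsto (fun N : ℕ => ((∑ i ∈ Finset.range N, x i : ℝ) : EReal)) atTop (𝓝 S))
    {ε : ℝ} (hε : 0 < ε) : ∃ᶠ i in atTop, x i ≤ ε := by
  intro hev
  obtain ⟨N₀, hN₀⟩ := eventually_atTop.1 hev
  refine hS (tendsto_nhds_unique h ?_)
  rw [EReal.tendsto_coe_nhds_top_iff, ← tendsto_add_atTop_iff_nat N₀]
  have hb : ∀ n : ℕ, ∑ i ∈ Finset.range N₀, x i + n * ε ≤ ∑ i ∈ Finset.range (n + N₀), x i := by
    intro n
    induction n with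
    | zero => simp
    | succ n ih =>
      rw [show n + 1 + N₀ = n + N₀ + 1 by ring, Finset.sum_range_succ]
      have := not_le.1 (hN₀ (n + N₀) (by omega))
      push_cast
      linarith
  exact tendsto_atTop_mono hb (tendsto_atTop_add_const_left _ _
    (tendsto_natCast_atTop_atTop.atTop_mul_const hε))

/-- The conclusion says that the supporting line at `x` is nonpositive at `0`: it lies below `Φ`,
and `Φ (b i) ≤ ε` infinitely often while `b i → 0`. -/
lemma convexOn_le_rightDeriv_mul {Φ : ℝ → ℝ} (hΦ : ConvexOn ℝ (Set.Ioo 0 1) Φ) {b : ℕ → ℝ}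
    (hb : ∀ n, b n ∈ Set.Ioo (0 : ℝ) 1) (hlim : Tendsto b atTop (𝓝 0))
    (hfreq : ∀ ε > 0, ∃ᶠ i in atTop, Φ (b i) ≤ ε) {x : ℝ} (hx : x ∈ Set.Ioo (0 : ℝ) 1) :
    Φ x ≤ derivWithin Φ (Set.Ioi x) x * x := by
  set c := derivWithin Φ (Set.Ioi x) x
  refine le_of_forall_pos_le_add fun η hη => ?_
  have h1 : Tendsto (fun n => c * b n) atTop (𝓝 0) := by simpa using hlim.const_mul c
  obtain ⟨i, hi, hi2⟩ := ((hfreq (η / 2) (by positivity)).and_eventually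
    (h1.eventually (lt_mem_nhds (show -(η / 2) < 0 by linarith)))).exists
  have h2 := convexOn_add_rightDeriv_mul_le hΦ (x := x) (y := b i)
    (by rwa [interior_Ioo]) (hb i)
  change Φ x + c * (b i - x) ≤ _ at h2
  linarith

/-- Summation by parts. -/
lemma sum_mul_eq_summation_by_parts (c d : ℕ → ℝ) (N : ℕ) :
    ∑ i ∈ Finset.range N, c i * d i = c N * ∑ i ∈ Finset.range N, d i
      + ∑ i ∈ Finset.range N, (c i - c (i + 1)) * ∑ j ∈ Finset.range (i + 1), d j := by
  induction N with
  | zero => simp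
  | succ N ih =>
    rw [Finset.sum_range_succ, ih, Finset.sum_range_succ d N,
      Finset.sum_range_succ (fun i => (c i - c (i + 1)) * ∑ j ∈ Finset.range (i + 1), d j) N,
      Finset.sum_range_succ d N]
    ring

/-- The gain of the `i`-th step in the comparison of `∑ Φ(a i)` with `∑ Φ(b i)`. -/
noncomputable def majorizationGain (Φ : ℝ → ℝ) (a b : ℕ → ℝ) (i : ℕ) : ℝ :=
  (Φ (b i) - Φ (a i) - derivWithin Φ (Set.Ioi (a i)) (a i) * (b i - a i)) +
    (derivWithin Φ (Set.Ioi (a i)) (a i) - derivWithin Φ (Set.Ioi (a (i + 1))) (a (i + 1))) *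
      ∑ j ∈ Finset.range (i + 1), (b j - a j)

section Majorization

variable {Φ : ℝ → ℝ} {a b : ℕ → ℝ} {m : ℝ}

lemma rightDeriv_succ_le (hΦ : ConvexOn ℝ (Set.Ioo 0 1) Φ) (ha : ∀ n, a n ∈ Set.Ioo (0 : ℝ) 1)
    (hanti : Antitone a) {i j : ℕ} (hij : i ≤ j) :
    derivWithin Φ (Set.Ioi (a j)) (a j) ≤ derivWithin Φ (Set.Ioi (a i)) (a i) :=
  hΦ.monotoneOn_rightDeriv (by rw [interior_Ioo]; exact ha _) (by rw [interior_Ioo]; exact ha _)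
    (hanti hij)

lemma sum_sub_nonneg (hmaj : ∀ n, ∑ i ∈ Finset.range n, a i ≤ ∑ i ∈ Finset.range n, b i) (n : ℕ) :
    0 ≤ ∑ j ∈ Finset.range n, (b j - a j) := by
  rw [Finset.sum_sub_distrib]
  exact sub_nonneg.2 (hmaj n)

lemma supporting_gap_nonneg (hΦ : ConvexOn ℝ (Set.Ioo 0 1) Φ) (ha : ∀ n, a n ∈ Set.Ioo (0 : ℝ) 1)
    (hb : ∀ n, b n ∈ Set.Ioo (0 : ℝ) 1) (i : ℕ) :
    0 ≤ Φ (b i) - Φ (a i) - derivWithin Φ (Set.Ioi (a i)) (a i) * (b i - a i) := by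
  have := convexOn_add_rightDeriv_mul_le hΦ (by rw [interior_Ioo]; exact ha i) (hb i)
  linarith

lemma majorizationGain_nonneg (hΦ : ConvexOn ℝ (Set.Ioo 0 1) Φ)
    (ha : ∀ n, a n ∈ Set.Ioo (0 : ℝ) 1) (hb : ∀ n, b n ∈ Set.Ioo (0 : ℝ) 1) (hanti : Antitone a)
    (hmaj : ∀ n, ∑ i ∈ Finset.range n, a i ≤ ∑ i ∈ Finset.range n, b i) (i : ℕ) :
    0 ≤ majorizationGain Φ a b i :=
  add_nonneg (supporting_gap_nonneg hΦ ha hb i)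
    (mul_nonneg (sub_nonneg.2 (rightDeriv_succ_le hΦ ha hanti i.le_succ)) (sum_sub_nonneg hmaj _))

/-- The slopes of the supporting lines at the `a i` are summed by parts against `b i - a i`. Only
the boundary term can be negative. -/
lemma sum_sub_sum_eq (Φ : ℝ → ℝ) (a b : ℕ → ℝ) (N : ℕ) :
    ∑ i ∈ Finset.range N, Φ (b i) - ∑ i ∈ Finset.range N, Φ (a i) =
      ∑ i ∈ Finset.range N, majorizationGain Φ a b i +
        derivWithin Φ (Set.Ioi (a N)) (a N) * ∑ i ∈ Finset.range N, (b i - a i) := by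
  have h := sum_mul_eq_summation_by_parts (fun i => derivWithin Φ (Set.Ioi (a i)) (a i))
    (fun i => b i - a i) N
  simp only [majorizationGain]
  rw [Finset.sum_add_distrib, Finset.sum_sub_distrib, Finset.sum_sub_distrib, h]
  ring

/-- The inequality between the sums of a convex function over two sequences, one majorizing the
other, with a remainder. -/
theorem add_sum_majorizationGain_le (hΦ : ConvexOn ℝ (Set.Ioo 0 1) Φ)
    (ha : ∀ n, a n ∈ Set.Ioo (0 : ℝ) 1) (hb : ∀ n, b n ∈ Set.Ioo (0 : ℝ) 1) (hanti : Antitone a)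
    (hsa : HasSum a m) (hsb : HasSum b m)
    (hmaj : ∀ n, ∑ i ∈ Finset.range n, a i ≤ ∑ i ∈ Finset.range n, b i) {S S' : EReal}
    (hS : Tendsto (fun N : ℕ => ((∑ i ∈ Finset.range N, Φ (a i) : ℝ) : EReal)) atTop (𝓝 S))
    (hS' : Tendsto (fun N : ℕ => ((∑ i ∈ Finset.range N, Φ (b i) : ℝ) : EReal)) atTop (𝓝 S'))
    (htop : S' ≠ ⊤) (K : ℕ) :
    S + (∑ i ∈ Finset.range K, majorizationGain Φ a b i : ℝ) ≤ S' := by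
  set R := ∑ i ∈ Finset.range K, majorizationGain Φ a b i with hR
  have hRle : ∀ N, K ≤ N → R ≤ ∑ i ∈ Finset.range N, majorizationGain Φ a b i := fun N hN =>
    Finset.sum_le_sum_of_subset_of_nonneg (Finset.range_mono hN)
      fun i _ _ => majorizationGain_nonneg hΦ ha hb hanti hmaj i
  by_cases hbot : S = ⊥
  · rw [hbot, EReal.bot_add]; exact bot_le
  set c : ℕ → ℝ := fun i => derivWithin Φ (Set.Ioi (a i)) (a i) with hc
  -- The slopes decrease. If they stay nonnegative, the boundary term is harmless. If they become
  -- negative, it is offset by the tail `∑_{i ≥ N} Φ (a i)`, which is at most `c N` times the tail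
  -- of `a`.
  by_cases hneg : ∃ N₀, c N₀ < 0
  · obtain ⟨N₀, hN₀⟩ := hneg
    have hcN : ∀ N, N₀ ≤ N → c N < 0 := fun N hN =>
      (rightDeriv_succ_le hΦ ha hanti hN).trans_lt hN₀
    have hfreq : ∀ ε > 0, ∃ᶠ i in atTop, Φ (b i) ≤ ε := fun ε hε =>
      frequently_le_of_tendsto_sum htop hS' hε
    have hterm : ∀ N i, N ≤ i → Φ (a i) ≤ c N * a i := fun N i hNi =>
      (convexOn_le_rightDeriv_mul hΦ hb hsb.summable.tendsto_atTop_zero hfreq (ha i)).trans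
        (mul_le_mul_of_nonneg_right (rightDeriv_succ_le hΦ ha hanti hNi) (ha i).1.le)
    have hM : ∀ N M, N ≤ M → ∑ i ∈ Finset.range M, Φ (a i) ≤ ∑ i ∈ Finset.range N, Φ (a i)
        + c N * (∑ i ∈ Finset.range M, a i - ∑ i ∈ Finset.range N, a i) := by
      intro N M hNM
      induction M, hNM using Nat.le_induction with
      | base => simp
      | succ M hNM ih =>
        rw [Finset.sum_range_succ, Finset.sum_range_succ a]
        have := hterm N M hNM
        linarith
    have hlimM : ∀ N, Tendsto (fun M => ((∑ i ∈ Finset.range N, Φ (a i)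
        + c N * (∑ i ∈ Finset.range M, a i - ∑ i ∈ Finset.range N, a i) : ℝ) : EReal)) atTop
        (𝓝 ((∑ i ∈ Finset.range N, Φ (a i)
          + c N * (m - ∑ i ∈ Finset.range N, a i) : ℝ) : EReal)) := fun N =>
      EReal.tendsto_coe.2 (((hsa.tendsto_sum_nat.sub_const _).const_mul _).const_add _)
    have hSle : ∀ N, S ≤ ((∑ i ∈ Finset.range N, Φ (a i)
          + c N * (m - ∑ i ∈ Finset.range N, a i) : ℝ) : EReal) := fun N =>
      le_of_tendsto_of_tendsto hS (hlimM N) (eventually_atTop.2 ⟨N, fun M hNM =>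
        EReal.coe_le_coe_iff.2 (hM N M hNM)⟩)
    have hStop : S ≠ ⊤ := fun h => by
      have := hSle 0
      rw [h, top_le_iff] at this
      exact EReal.coe_ne_top _ this
    lift S to ℝ using ⟨hStop, hbot⟩
    rw [← EReal.coe_add]
    refine ge_of_tendsto hS' (eventually_atTop.2 ⟨max K N₀, fun N hN => ?_⟩)
    rw [EReal.coe_le_coe_iff]
    have h1 := EReal.coe_le_coe_iff.1 (hSle N)
    have h2 := hRle N ((le_max_left _ _).trans hN)
    have h3 := hcN N ((le_max_right _ _).trans hN)
    have h4 := sum_sub_sum_eq Φ a b N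
    change _ = _ + c N * _ at h4
    have h5 : ∑ i ∈ Finset.range N, b i ≤ m :=
      sum_le_hasSum _ (fun i _ => (hb i).1.le) hsb
    rw [Finset.sum_sub_distrib] at h4
    -- After the tail estimate, the boundary contribution is `c N * (∑_{i < N} b i - m)`, a product
    -- of two nonpositive factors.
    nlinarith
  · push Not at hneg
    have hlim : Tendsto (fun N : ℕ => ((∑ i ∈ Finset.range N, Φ (a i) : ℝ) : EReal) + (R : EReal))
        atTop (𝓝 (S + (R : EReal))) :=
      (EReal.continuousAt_add (p := (S, (R : EReal))) (Or.inr (EReal.coe_ne_bot _))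
        (Or.inr (EReal.coe_ne_top _))).tendsto.comp (hS.prodMk_nhds tendsto_const_nhds)
    refine le_of_tendsto_of_tendsto hlim hS' (eventually_atTop.2 ⟨K, fun N hN => ?_⟩)
    simp only []
    rw [← EReal.coe_add, EReal.coe_le_coe_iff]
    have h2 := hRle N hN
    have h4 := sum_sub_sum_eq Φ a b N
    have h5 := mul_nonneg (hneg N) (sum_sub_nonneg hmaj N)
    simp only [hc] at h5
    linarith

/-- If one sequence is strictly majorized by another, equal finite sums of a convex function over
both force this function to be affine. -/
theorem exists_affine_of_sum_eq (hΦ : ConvexOn ℝ (Set.Ioo 0 1) Φ)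
    (ha : ∀ n, a n ∈ Set.Ioo (0 : ℝ) 1) (hb : ∀ n, b n ∈ Set.Ioo (0 : ℝ) 1) (hanti : Antitone a)
    (hsa : HasSum a m) (hsb : HasSum b m)
    (hmaj : ∀ n, n ≠ 0 → ∑ i ∈ Finset.range n, a i < ∑ i ∈ Finset.range n, b i) {S : EReal}
    (hS : Tendsto (fun N : ℕ => ((∑ i ∈ Finset.range N, Φ (a i) : ℝ) : EReal)) atTop (𝓝 S))
    (hS' : Tendsto (fun N : ℕ => ((∑ i ∈ Finset.range N, Φ (b i) : ℝ) : EReal)) atTop (𝓝 S))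
    (htop : S ≠ ⊤) (hbot : S ≠ ⊥) :
    ∃ α β : ℝ, ∀ t ∈ Set.Ioo 0 (b 0), Φ t = α * t + β := by
  have hmaj' : ∀ n, ∑ i ∈ Finset.range n, a i ≤ ∑ i ∈ Finset.range n, b i := fun n => by
    by_cases hn : n = 0
    · simp [hn]
    · exact (hmaj n hn).le
  have hg := majorizationGain_nonneg hΦ ha hb hanti hmaj'
  have hgz : ∀ i, majorizationGain Φ a b i = 0 := by
    intro i
    have h := add_sum_majorizationGain_le hΦ ha hb hanti hsa hsb hmaj' hS hS' htop (i + 1)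
    lift S to ℝ using ⟨htop, hbot⟩
    rw [← EReal.coe_add, EReal.coe_le_coe_iff] at h
    have h1 := Finset.single_le_sum (f := majorizationGain Φ a b) (fun j _ => hg j)
      (Finset.self_mem_range_succ i)
    linarith [hg i]
  set c : ℕ → ℝ := fun i => derivWithin Φ (Set.Ioi (a i)) (a i) with hc
  -- Both summands of each gain vanish. As the partial-sum differences are positive, all slopes
  -- agree, and `Φ` meets the supporting line at `a i` again at `b i`.
  have hsplit : ∀ i, c i = c (i + 1) ∧ Φ (b i) = Φ (a i) + c i * (b i - a i) := by
    intro i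
    have h1 := supporting_gap_nonneg hΦ ha hb i
    have h2 : 0 ≤ c i - c (i + 1) := sub_nonneg.2 (rightDeriv_succ_le hΦ ha hanti i.le_succ)
    have h3 : 0 < ∑ j ∈ Finset.range (i + 1), (b j - a j) := by
      rw [Finset.sum_sub_distrib]; exact sub_pos.2 (hmaj _ (by omega))
    have h4 := hgz i
    have h5 := mul_nonneg h2 h3.le
    change (_ - c i * _) + (c i - c (i + 1)) * _ = 0 at h4
    change 0 ≤ _ - c i * _ at h1
    have h6 : (c i - c (i + 1)) * ∑ j ∈ Finset.range (i + 1), (b j - a j) = 0 := by linarith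
    rw [mul_eq_zero, or_iff_left h3.ne'] at h6
    exact ⟨by linarith, by linarith⟩
  have hcc : ∀ i, c i = c 0 := fun i => by
    induction i with
    | zero => rfl
    | succ i ih => rw [← (hsplit i).1, ih]
  have hsupp : ∀ k, ∀ x ∈ Set.Ioo (0 : ℝ) 1, Φ (a k) + c 0 * (x - a k) ≤ Φ x := by
    intro k x hx
    rw [← hcc k]
    exact convexOn_add_rightDeriv_mul_le hΦ (by rw [interior_Ioo]; exact ha k) hx
  -- Supporting lines of equal slope coincide, so one line lies below `Φ` and touches it at every `a
  -- k` and at `b 0`. Convexity bounds `Φ` by this line on `[a k, b 0]`, and `a k → 0`.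
  refine ⟨c 0, Φ (a 0) - c 0 * a 0, fun t ht => ?_⟩
  have ht1 : t ∈ Set.Ioo (0 : ℝ) 1 := ⟨ht.1, ht.2.trans (hb 0).2⟩
  refine le_antisymm ?_ (by linarith [hsupp 0 t ht1])
  obtain ⟨k, hk⟩ := (hsa.summable.tendsto_atTop_zero.eventually (gt_mem_nhds ht.1)).exists
  have h1 : Φ (a k) = Φ (a 0) + c 0 * (a k - a 0) :=
    le_antisymm (by linarith [hsupp k _ (ha 0)]) (hsupp 0 _ (ha k))
  have h2 := (hsplit 0).2
  have hkb : a k < b 0 := hk.trans ht.2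
  have h3 := hΦ.2 (ha k) (hb 0) (show 0 ≤ (b 0 - t) / (b 0 - a k) from
    div_nonneg (by linarith [ht.2]) (by linarith))
    (show 0 ≤ (t - a k) / (b 0 - a k) from div_nonneg (by linarith) (by linarith))
    (by rw [← add_div, div_eq_one_iff_eq (by linarith)]; ring)
  have hne : b 0 - a k ≠ 0 := by linarith
  have h4 : ((b 0 - t) / (b 0 - a k)) • a k + ((t - a k) / (b 0 - a k)) • b 0 = t := by
    simp only [smul_eq_mul]; field_simp; ring
  rw [h4, h1, h2] at h3
  refine h3.trans (le_of_eq ?_)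
  simp only [smul_eq_mul]
  field_simp
  ring

end Majorization

/-! ### Eigenvalues of diagonal operators -/

/-- A positive sequence tending to zero can be listed in decreasing order. -/
theorem exists_perm_antitone {μ : ℕ → ℝ} (hpos : ∀ k, 0 < μ k) (hlim : Tendsto μ atTop (𝓝 0)) :
    ∃ σ : Equiv.Perm ℕ, Antitone (μ ∘ σ) := by
  have hfin : ∀ t > 0, {k | t ≤ μ k}.Finite := by
    intro t ht
    have h := hlim.eventually (gt_mem_nhds ht)
    rw [← Nat.cofinite_eq_atTop, eventually_cofinite] at h
    simpa only [not_lt] using h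
  have hmax : ∀ s : Finset ℕ, ∃ k, k ∉ s ∧ ∀ j, j ∉ s → μ j ≤ μ k := by
    intro s
    obtain ⟨j₀, hj₀⟩ := Infinite.exists_notMem_finset s
    obtain ⟨k, hk, hkmax⟩ := Set.exists_max_image ({k | μ j₀ ≤ μ k} \ s) μ
      ((hfin _ (hpos j₀)).sdiff) ⟨j₀, le_refl (μ j₀), by simpa using hj₀⟩
    refine ⟨k, by simpa using hk.2, fun j hj => ?_⟩
    by_cases h : μ j₀ ≤ μ j
    · exact hkmax j ⟨h, by simpa using hj⟩
    · exact (not_le.1 h).le.trans hk.1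
  choose g hg hgmax using hmax
  let s : ℕ → Finset ℕ := fun n => Nat.rec ∅ (fun _ t => insert (g t) t) n
  have hs : ∀ n, s (n + 1) = insert (g (s n)) (s n) := fun n => rfl
  have hmono : Monotone s := monotone_nat_of_le_succ fun n => by
    rw [hs]; exact Finset.subset_insert _ _
  set f : ℕ → ℕ := fun n => g (s n) with hf
  have hmem : ∀ i j, i < j → f i ∈ s j := fun i j hij =>
    hmono (Nat.succ_le_of_lt hij) (by rw [hs]; exact Finset.mem_insert_self _ _)
  have hinj : Function.Injective f := by
    intro i j hij
    by_contra hne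
    rcases lt_or_gt_of_ne hne with h | h
    · exact hg (s j) (by rw [← show f j = g (s j) from rfl, ← hij]; exact hmem i j h)
    · exact hg (s i) (by rw [← show f i = g (s i) from rfl, hij]; exact hmem j i h)
  have hanti : Antitone (μ ∘ f) := antitone_nat_of_succ_le fun n =>
    hgmax (s n) _ fun h => hg (s (n + 1)) (hmono n.le_succ h)
  have hsmem : ∀ n k, k ∈ s n → ∃ i, f i = k := by
    intro n
    induction n with
    | zero => intro k hk; exact absurd hk (Finset.notMem_empty k)
    | succ n ih =>
      intro k hk
      rw [hs, Finset.mem_insert] at hk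
      exact hk.elim (fun h => ⟨n, h.symm⟩) (ih k)
  -- The greedy choice omits no index `k`: otherwise infinitely many distinct chosen terms would be
  -- at least `μ k > 0`.
  have hsurj : Function.Surjective f := by
    intro k
    by_contra hk
    have hle : ∀ n, μ k ≤ μ (f n) := fun n => hgmax (s n) k fun h => hk (hsmem n k h)
    exact Set.infinite_of_injective_forall_mem hinj (s := {j | μ k ≤ μ j}) hle (hfin _ (hpos k))
  exact ⟨Equiv.ofBijective f ⟨hinj, hsurj⟩, hanti⟩

section Spectral

variable {H : Type*} [NormedAddCommGroup H] [InnerProductSpace ℂ H] {T : H →L[ℂ] H} {e : ℕ → H}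
  {μ : ℕ → ℝ}

lemma apply_eq_smul_of_inner (he : Orthonormal ℂ e)
    (htot : ∀ x : H, (∀ k, inner ℂ (e k) x = 0) → x = 0)
    (hT : ∀ k x, inner ℂ (e k) (T x) = μ k * inner ℂ (e k) x) (k : ℕ) :
    T (e k) = (μ k : ℂ) • e k := by
  rw [← sub_eq_zero]
  refine htot _ fun j => ?_
  rw [inner_sub_right, hT, inner_smul_right, orthonormal_iff_ite.1 he]
  split_ifs with h
  · rw [h, sub_self]
  · simp

/-- An eigenvector for `ν ≥ t` is orthogonal to every `e k` with `μ k < t`; only finitely many `e k`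
remain, so totality makes it a finite combination of these. -/
lemma iSup_eigenspace_eq_span (he : Orthonormal ℂ e)
    (htot : ∀ x : H, (∀ k, inner ℂ (e k) x = 0) → x = 0)
    (hT : ∀ k x, inner ℂ (e k) (T x) = μ k * inner ℂ (e k) x) {t : ℝ}
    (hfin : {k | t ≤ μ k}.Finite) :
    (⨆ ν ∈ Set.Ici t, Module.End.eigenspace (T : H →ₗ[ℂ] H) (ν : ℂ)) =
      Submodule.span ℂ (e '' {k | t ≤ μ k}) := by
  refine le_antisymm (iSup₂_le fun ν hν x hx => ?_) (Submodule.span_le.2 ?_)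
  · rw [Module.End.mem_eigenspace_iff] at hx
    have hx' : T x = (ν : ℂ) • x := hx
    have hz : ∀ k, μ k < t → inner ℂ (e k) x = 0 := by
      intro k hk
      have h := hT k x
      rw [hx', inner_smul_right, ← sub_eq_zero, ← sub_mul, mul_eq_zero, sub_eq_zero] at h
      refine h.resolve_left fun h => ?_
      rw [Complex.ofReal_inj] at h
      have : t ≤ ν := hν
      linarith
    have hsum : x = ∑ k ∈ hfin.toFinset, inner ℂ (e k) x • e k := by
      rw [← sub_eq_zero]
      refine htot _ fun j => ?_
      rw [inner_sub_right, sub_eq_zero]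
      by_cases hj : j ∈ hfin.toFinset
      · rw [he.inner_right_sum _ hj]
      · rw [hz j (not_le.1 fun h => hj (hfin.mem_toFinset.2 h)), inner_sum]
        refine (Finset.sum_eq_zero fun k hk => ?_).symm
        rw [inner_smul_right, orthonormal_iff_ite.1 he, if_neg (fun h : j = k => hj (h ▸ hk)), mul_zero]
    rw [hsum]
    refine Submodule.sum_mem _ fun k hk => Submodule.smul_mem _ _ (Submodule.subset_span ?_)
    exact ⟨k, hfin.mem_toFinset.1 hk, rfl⟩
  · rintro _ ⟨k, hk, rfl⟩
    refine Submodule.mem_iSup_of_mem (μ k) (Submodule.mem_iSup_of_mem hk ?_)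
    rw [Module.End.mem_eigenspace_iff]
    exact apply_eq_smul_of_inner he htot hT k

/-- The `n`-th eigenvalue of a diagonal operator, in terms of a decreasing arrangement of its
diagonal entries. -/
theorem nthEigenvalue_succ_eq (he : Orthonormal ℂ e)
    (htot : ∀ x : H, (∀ k, inner ℂ (e k) x = 0) → x = 0)
    (hT : ∀ k x, inner ℂ (e k) (T x) = μ k * inner ℂ (e k) x)
    (hpos : ∀ k, 0 < μ k) (hlim : Tendsto μ atTop (𝓝 0)) {σ : Equiv.Perm ℕ}
    (hσ : Antitone (μ ∘ σ)) (n : ℕ) : nthEigenvalue T (n + 1) = μ (σ n) := by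
  have hfin : ∀ t > 0, {k | t ≤ μ k}.Finite := by
    intro t ht
    have h := hlim.eventually (gt_mem_nhds ht)
    rw [← Nat.cofinite_eq_atTop, eventually_cofinite] at h
    simpa only [not_lt] using h
  have hrank : ∀ t : ℝ, 0 < t → Module.rank ℂ
      ↥(⨆ ν ∈ Set.Ici t, Module.End.eigenspace (T : H →ₗ[ℂ] H) (ν : ℂ)) =
        ({k | t ≤ μ k}.ncard : Cardinal) := by
    intro t ht
    rw [iSup_eigenspace_eq_span he htot hT (hfin t ht),
      rank_span_set ((he.linearIndependent.linearIndepOn _).id_image),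
      ← Set.cast_ncard ((hfin t ht).image e),
      Set.ncard_image_of_injective _ he.linearIndependent.injective]
  have hset : ∀ t : ℝ, {k | t ≤ μ k} = σ '' {i | t ≤ μ (σ i)} := fun t => by
    ext k
    exact ⟨fun hk => ⟨σ.symm k, by simpa using hk, by simp⟩, fun ⟨i, hi, hik⟩ => hik ▸ hi⟩
  have hcard : ∀ t : ℝ, {k | t ≤ μ k}.ncard = {i | t ≤ μ (σ i)}.ncard := fun t => by
    rw [hset, Set.ncard_image_of_injective _ σ.injective]
  -- The rank for `t > 0` counts the `k` with `μ k ≥ t`. It is at least `n + 1` at `t = μ (σ n)` and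
  -- at most `n` for larger `t`, so the supremum is attained there.
  refine IsGreatest.csSup_eq ⟨⟨hpos _, ?_⟩, fun t ⟨ht, hn⟩ => ?_⟩
  · rw [hrank _ (hpos _), hcard, Nat.cast_le]
    have hsub : (Finset.range (n + 1) : Set ℕ) ⊆ {i | μ (σ n) ≤ μ (σ i)} := fun i hi =>
      hσ (Nat.lt_succ_iff.1 (Finset.mem_range.1 hi))
    have hf : {i | μ (σ n) ≤ μ (σ i)}.Finite :=
      Set.Finite.preimage (s := {k | μ (σ n) ≤ μ k}) σ.injective.injOn (hfin _ (hpos (σ n)))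
    have := Set.ncard_le_ncard hsub hf
    rwa [Set.ncard_coe_finset, Finset.card_range] at this
  · rw [hrank t ht, hcard, Nat.cast_le] at hn
    by_contra hlt
    have hsub : {i | t ≤ μ (σ i)} ⊆ (Finset.range n : Set ℕ) := fun i hi => by
      rw [Finset.coe_range, Set.mem_Iio]
      by_contra hni
      have h1 : μ (σ i) ≤ μ (σ n) := hσ (not_lt.1 hni)
      have h2 : t ≤ μ (σ i) := hi
      linarith
    have := Set.ncard_le_ncard hsub (Finset.finite_toSet _)
    rw [Set.ncard_coe_finset, Finset.card_range] at this
    omega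

end Spectral

/-! ### Area coordinates and integrals over radial sets -/

lemma measurable_area : Measurable fun z : ℂ => Real.pi * ‖z‖ ^ 2 := by fun_prop

/-- The area `π ‖z‖²` of the disc through `z` transports the Lebesgue measure of the plane to the
one of the half-line. -/
lemma map_area : Measure.map (fun z : ℂ => Real.pi * ‖z‖ ^ 2) volume
    = volume.restrict (Set.Ioi 0) := by
  have hIic : ∀ x : ℝ, Measure.map (fun z : ℂ => Real.pi * ‖z‖ ^ 2) volume (Set.Iic x)
      = ENNReal.ofReal x := by
    intro x
    rw [Measure.map_apply measurable_area measurableSet_Iic]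
    rcases lt_or_ge x 0 with hx | hx
    · rw [ENNReal.ofReal_of_nonpos hx.le]
      convert measure_empty (μ := (volume : Measure ℂ))
      ext z
      simp only [Set.mem_preimage, Set.mem_Iic, Set.mem_empty_iff_false, iff_false, not_le]
      exact hx.trans_le (by positivity)
    · have : (fun z : ℂ => Real.pi * ‖z‖ ^ 2) ⁻¹' Set.Iic x
          = Metric.closedBall 0 (Real.sqrt (x / Real.pi)) := by
        ext z
        rw [Set.mem_preimage, Set.mem_Iic, mem_closedBall_zero_iff,
          Real.le_sqrt (norm_nonneg _) (by positivity), le_div_iff₀ Real.pi_pos, mul_comm]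
      rw [this, Complex.volume_closedBall, ← ENNReal.ofReal_pow (Real.sqrt_nonneg _),
        Real.sq_sqrt (by positivity), ← ENNReal.ofReal_coe_nnreal, NNReal.coe_real_pi,
        ← ENNReal.ofReal_mul (by positivity), div_mul_cancel₀ _ Real.pi_pos.ne']
  refine Measure.ext_of_generateFrom_of_iUnion (Set.range Set.Iic) (fun n : ℕ => Set.Iic (n : ℝ))
    (by rw [← borel_eq_generateFrom_Iic]; exact BorelSpace.measurable_eq) isPiSystem_Iic ?_
    (fun n => ⟨n, rfl⟩) (fun n => by rw [hIic]; exact ENNReal.ofReal_ne_top) ?_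
  · rw [Set.eq_univ_iff_forall]
    intro x
    obtain ⟨n, hn⟩ := exists_nat_ge x
    exact Set.mem_iUnion.2 ⟨n, hn⟩
  · rintro _ ⟨x, rfl⟩
    rw [hIic, Measure.restrict_apply measurableSet_Iic, Set.inter_comm, Set.Ioi_inter_Iic,
      Real.volume_Ioc, sub_zero]

lemma volume_area_preimage {A : Set ℝ} (hA : MeasurableSet A) (w : ℂ) :
    volume {z : ℂ | Real.pi * ‖z - w‖ ^ 2 ∈ A} = volume (A ∩ Set.Ioi 0) := by
  rw [← Measure.restrict_apply hA, ← map_area, Measure.map_apply measurable_area hA]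
  exact (measurePreserving_sub_right volume w).measure_preimage
    (measurable_area hA).nullMeasurableSet

/-- Cauchy's formula for the Taylor coefficients, on the circle through `z`. -/
lemma integral_circle_mul_exp {G : ℂ → ℂ} (hG : Differentiable ℂ G) (k : ℕ) (z : ℂ) :
    ∫ θ in (0 : ℝ)..2 * Real.pi, G (Complex.exp (θ * Complex.I) * z) *
      Complex.exp (-(k * (θ * Complex.I)))
      = 2 * Real.pi * (iteratedDeriv k G 0 / k.factorial * z ^ k) := by
  have hd : Differentiable ℂ fun ζ => G (z * ζ) := hG.comp (differentiable_id.const_mul z)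
  have h := DifferentiableOn.circleIntegral_one_div_sub_center_pow_smul one_pos k
    (hd.differentiableOn (s := Metric.closedBall 0 1))
  rw [iteratedDeriv_comp_const_mul hG.contDiff] at h
  simp only [circleIntegral, deriv_circleMap, circleMap, Complex.ofReal_one, one_mul, zero_add,
    sub_zero, smul_eq_mul, mul_zero] at h
  have h2 : ∀ θ : ℝ, Complex.exp (θ * Complex.I) * Complex.I *
      (1 / Complex.exp (θ * Complex.I) ^ (k + 1) * G (z * Complex.exp (θ * Complex.I)))
      = Complex.I * (G (Complex.exp (θ * Complex.I) * z) *
        Complex.exp (-(k * (θ * Complex.I)))) := by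
    intro θ
    have hne := Complex.exp_ne_zero (θ * Complex.I)
    rw [Complex.exp_neg, Complex.exp_nat_mul, mul_comm z]
    field_simp
    ring
  simp only [h2] at h
  rw [intervalIntegral.integral_const_mul] at h
  refine mul_left_cancel₀ Complex.I_ne_zero (h.trans ?_)
  ring

lemma norm_exp_ofReal_mul_I_mul (θ : ℝ) (z : ℂ) : ‖Complex.exp (θ * Complex.I) * z‖ = ‖z‖ := by
  rw [norm_mul, Complex.norm_exp_ofReal_mul_I, one_mul]

lemma measurePreserving_exp_mul (θ : ℝ) :
    MeasurePreserving (fun z : ℂ => Complex.exp (θ * Complex.I) * z) := by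
  have h := (rotation (Circle.exp θ)).measurePreserving
  have e : ⇑(rotation (Circle.exp θ)) = fun z : ℂ => Complex.exp (θ * Complex.I) * z :=
    funext fun z => by rw [rotation_apply, Circle.coe_exp]
  rwa [e] at h

/-- On a radial set, an entire function is seen by `conj z ^ k` only through its `k`-th Taylor
coefficient. -/
theorem integral_radial_mul_conj_pow {G : ℂ → ℂ} (hG : Differentiable ℂ G) (k : ℕ)
    {ρ : ℝ → ℝ} (hρ : Measurable ρ)
    (hint : Integrable fun z : ℂ => G z * (conj z ^ k * ρ ‖z‖)) :
    ∫ z : ℂ, G z * (conj z ^ k * ρ ‖z‖) =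
      iteratedDeriv k G 0 / k.factorial * ∫ z : ℂ, ((‖z‖ ^ (2 * k) * ρ ‖z‖ : ℝ) : ℂ) := by
  set h : ℂ → ℂ := fun z => conj z ^ k * ρ ‖z‖ with hh
  have hrot : ∀ (θ : ℝ) (z : ℂ), h (Complex.exp (θ * Complex.I) * z)
      = Complex.exp (-(k * (θ * Complex.I))) * h z := by
    intro θ z
    simp only [hh]
    rw [norm_exp_ofReal_mul_I_mul, map_mul, mul_pow, ← Complex.exp_conj, ← Complex.exp_nat_mul]
    simp only [map_mul, Complex.conj_ofReal, Complex.conj_I, mul_neg]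
    ring
  have hmeas : Measurable h := by
    have : Measurable fun z : ℂ => ((ρ ‖z‖ : ℝ) : ℂ) :=
      Complex.measurable_ofReal.comp (hρ.comp measurable_norm)
    exact ((Complex.continuous_conj.measurable).pow_const k).mul this
  -- The integral over the plane is invariant under rotation by `θ`. Integrating over `θ` and
  -- exchanging the integrals turns `G` into its `k`-th Fourier mode on each circle, which Cauchy's
  -- formula evaluates.
  set f : ℝ → ℂ → ℂ := fun θ z => G (Complex.exp (θ * Complex.I) * z) *
    h (Complex.exp (θ * Complex.I) * z) with hf
  have hfθ : ∀ θ, Integrable (f θ) := fun θ =>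
    (measurePreserving_exp_mul θ).integrable_comp_of_integrable hint
  have hIθ : ∀ θ, ∫ z, f θ z = ∫ z, G z * h z := fun θ =>
    (measurePreserving_exp_mul θ).integral_comp
      (Homeomorph.mulLeft₀ _ (Complex.exp_ne_zero _)).measurableEmbedding (fun z => G z * h z)
  have hNθ : ∀ θ, ∫ z, ‖f θ z‖ = ∫ z, ‖G z * h z‖ := fun θ =>
    (measurePreserving_exp_mul θ).integral_comp
      (Homeomorph.mulLeft₀ _ (Complex.exp_ne_zero _)).measurableEmbedding (fun z => ‖G z * h z‖)
  have hprod : Integrable (Function.uncurry f)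
      ((volume.restrict (Set.Ioc 0 (2 * Real.pi))).prod volume) := by
    have hm : Measurable (Function.uncurry f) := by
      have h1 : Measurable fun p : ℝ × ℂ => Complex.exp (p.1 * Complex.I) * p.2 := by fun_prop
      exact (hG.continuous.measurable.comp h1).mul (hmeas.comp h1)
    rw [integrable_prod_iff hm.aestronglyMeasurable]
    refine ⟨ae_of_all _ hfθ, ?_⟩
    simp only [Function.uncurry_apply_pair, hNθ]
    exact integrable_const _
  have hswap := integral_integral_swap hprod
  have hinner : ∀ z, ∫ θ in Set.Ioc 0 (2 * Real.pi), f θ z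
      = 2 * Real.pi * (iteratedDeriv k G 0 / k.factorial * ((‖z‖ ^ (2 * k) * ρ ‖z‖ : ℝ) : ℂ)) := by
    intro z
    rw [← intervalIntegral.integral_of_le (by positivity)]
    have e : ∀ θ : ℝ, f θ z = G (Complex.exp (θ * Complex.I) * z) *
        Complex.exp (-(k * (θ * Complex.I))) * h z := fun θ => by
      simp only [hf, hrot]; ring
    simp only [e]
    rw [intervalIntegral.integral_mul_const, integral_circle_mul_exp hG]
    have hz : z ^ k * conj z ^ k = ((‖z‖ ^ (2 * k) : ℝ) : ℂ) := by
      rw [← mul_pow, Complex.mul_conj', pow_mul]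
      push_cast
      ring
    simp only [hh]
    rw [Complex.ofReal_mul, ← hz]
    ring
  simp only [hIθ, hinner] at hswap
  rw [setIntegral_const, measureReal_def, Real.volume_Ioc, sub_zero,
    ENNReal.toReal_ofReal (by positivity), integral_const_mul, integral_const_mul,
    Complex.real_smul] at hswap
  have hpi : ((2 * Real.pi : ℝ) : ℂ) ≠ 0 := by
    rw [Complex.ofReal_ne_zero]; positivity
  refine mul_left_cancel₀ hpi (hswap.trans ?_)
  push_cast
  rfl

/-- The diagonal entries of the Toeplitz operator of a radial set. -/
noncomputable def poissonMass (A : Set ℝ) (k : ℕ) : ℝ := ∫ s in A, poissonWeight k s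

lemma integral_area_indicator {A : Set ℝ} (hA : MeasurableSet A) (hA0 : A ⊆ Set.Ioi 0) (k : ℕ) :
    ∫ z : ℂ, ‖z‖ ^ (2 * k) * (A.indicator (fun s => Real.exp (-s)) (Real.pi * ‖z‖ ^ 2))
      = k.factorial / Real.pi ^ k * poissonMass A k := by
  have h1 : poissonMass A k
      = ∫ s in Set.Ioi 0, A.indicator (poissonWeight k) s := by
    rw [setIntegral_indicator hA, Set.inter_eq_right.2 hA0, poissonMass]
  rw [h1, ← map_area, integral_map measurable_area.aemeasurable
    ((continuous_poissonWeight k).measurable.indicator hA).aestronglyMeasurable,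
    ← integral_const_mul]
  refine integral_congr_ae (ae_of_all _ fun z => ?_)
  simp only []
  by_cases hz : Real.pi * ‖z‖ ^ 2 ∈ A
  · rw [Set.indicator_of_mem hz, Set.indicator_of_mem hz, poissonWeight, mul_pow, pow_mul]
    have : (k.factorial : ℝ) ≠ 0 := by positivity
    have := Real.pi_ne_zero
    field_simp
  · rw [Set.indicator_of_notMem hz, Set.indicator_of_notMem hz, mul_zero, mul_zero]

lemma toReal_weight (z : ℂ) : (ENNReal.ofReal (Real.exp (-Real.pi * ‖z‖ ^ 2))).toReal
    = Real.exp (-Real.pi * ‖z‖ ^ 2) := ENNReal.toReal_ofReal (Real.exp_pos _).le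

lemma integral_gaussianMeasure (f : ℂ → ℂ) :
    ∫ z, f z ∂gaussianMeasure = ∫ z, (Real.exp (-Real.pi * ‖z‖ ^ 2) : ℂ) * f z := by
  rw [gaussianMeasure, integral_withDensity_eq_integral_toReal_smul measurable_weight
    (ae_of_all _ fun z => ENNReal.ofReal_lt_top)]
  simp only [toReal_weight, Complex.real_smul]

lemma integrable_gaussianMeasure_iff {E : Type*} [NormedAddCommGroup E] [NormedSpace ℝ E]
    {f : ℂ → E} : Integrable f gaussianMeasure ↔
      Integrable fun z => Real.exp (-Real.pi * ‖z‖ ^ 2) • f z := by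
  rw [gaussianMeasure, integrable_withDensity_iff_integrable_smul' measurable_weight
    (ae_of_all _ fun z => ENNReal.ofReal_lt_top)]
  simp only [toReal_weight]

/-! ### Translated monomials and diagonalization of the Toeplitz operator -/

/-- The normalized monomials of the Fock space, centred at `w`. -/
noncomputable def fockMonomial (w : ℂ) (k : ℕ) (z : ℂ) : ℂ :=
  (Real.sqrt (Real.pi ^ k / k.factorial) : ℂ) *
    ((z - w) ^ k * Complex.exp (Real.pi * conj w * z - Real.pi * (w * conj w) / 2))

/-- The translation of an entire function that preserves the Fock norm. -/
noncomputable def fockTranslate (w : ℂ) (F : ℂ → ℂ) (z : ℂ) : ℂ :=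
  F (z + w) * Complex.exp (-(Real.pi * conj w * z) - Real.pi * (w * conj w) / 2)

lemma differentiable_fockMonomial (w : ℂ) (k : ℕ) : Differentiable ℂ (fockMonomial w k) := by
  unfold fockMonomial; fun_prop

lemma differentiable_fockTranslate (w : ℂ) {F : ℂ → ℂ} (hF : Differentiable ℂ F) :
    Differentiable ℂ (fockTranslate w F) := by
  unfold fockTranslate
  have : Differentiable ℂ fun z => F (z + w) := hF.comp (differentiable_id.add_const w)
  fun_prop

lemma fockTranslate_fockMonomial (w : ℂ) (k : ℕ) : fockTranslate w (fockMonomial w k)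
    = fun z => (Real.sqrt (Real.pi ^ k / k.factorial) : ℂ) * z ^ k := by
  ext z
  rw [fockTranslate, fockMonomial, add_sub_cancel_right, mul_assoc, mul_assoc, ← Complex.exp_add]
  have : Real.pi * conj w * (z + w) - Real.pi * (w * conj w) / 2
      + (-(Real.pi * conj w * z) - Real.pi * (w * conj w) / 2) = 0 := by ring
  rw [this, Complex.exp_zero, mul_one]

/-- Expanding `|z + w|²` in the Gaussian cancels the exponential factors of the translated monomial,
leaving the centred Gaussian and `conj z ^ k`. Every pairing with `fockMonomial w k` thereby becomes
a pairing at the origin. -/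
lemma exp_mul_conj_fockMonomial_mul (w : ℂ) (k : ℕ) (F : ℂ → ℂ) (z : ℂ) :
    (Real.exp (-Real.pi * ‖z + w‖ ^ 2) : ℂ) * (F (z + w) * conj (fockMonomial w k (z + w)))
      = (Real.sqrt (Real.pi ^ k / k.factorial) : ℂ) *
        (fockTranslate w F z * (conj z ^ k * (Real.exp (-(Real.pi * ‖z‖ ^ 2)) : ℝ))) := by
  rw [fockMonomial, fockTranslate, add_sub_cancel_right]
  simp only [map_mul, map_pow, Complex.conj_ofReal, ← Complex.exp_conj, map_sub, map_add,
    Complex.conj_conj, map_div₀, map_ofNat, Complex.ofReal_exp, Complex.ofReal_mul,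
    Complex.ofReal_neg, Complex.ofReal_pow, ← Complex.mul_conj']
  have h : Complex.exp (-Real.pi * ((z + w) * (conj z + conj w))) *
      Complex.exp (Real.pi * w * (conj z + conj w) - Real.pi * (conj w * w) / 2)
      = Complex.exp (-(Real.pi * conj w * z) - Real.pi * (w * conj w) / 2) *
        Complex.exp (-(Real.pi * (z * conj z))) := by
    rw [← Complex.exp_add, ← Complex.exp_add]
    congr 1
    ring
  linear_combination (Real.sqrt (Real.pi ^ k / k.factorial) : ℂ) * F (z + w) * conj z ^ k * h

lemma exp_mul_norm_fockMonomial_sq (w : ℂ) (k : ℕ) (z : ℂ) :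
    Real.exp (-Real.pi * ‖z‖ ^ 2) * ‖fockMonomial w k z‖ ^ 2
      = poissonWeight k (Real.pi * ‖z - w‖ ^ 2) := by
  rw [fockMonomial, norm_mul, norm_mul, norm_pow, Complex.norm_exp, Complex.norm_real,
    Real.norm_of_nonneg (Real.sqrt_nonneg _), mul_pow, mul_pow, Real.sq_sqrt (by positivity),
    ← Real.exp_nat_mul, poissonWeight]
  have h : Real.exp (-Real.pi * ‖z‖ ^ 2) * Real.exp ((2 : ℕ) *
      (Real.pi * conj w * z - Real.pi * (w * conj w) / 2 : ℂ).re)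
      = Real.exp (-(Real.pi * ‖z - w‖ ^ 2)) := by
    rw [← Real.exp_add]
    congr 1
    have e : (Real.pi * conj w * z - Real.pi * (w * conj w) / 2 : ℂ).re
        = Real.pi * (w.re * z.re + w.im * z.im) - Real.pi * (w.re ^ 2 + w.im ^ 2) / 2 := by
      have : (Real.pi * conj w * z - Real.pi * (w * conj w) / 2 : ℂ)
          = ((Real.pi : ℝ) : ℂ) * (conj w * z) - ((Real.pi / 2 : ℝ) : ℂ) * (w * conj w) := by
        push_cast; ring
      rw [this, Complex.sub_re, Complex.re_ofReal_mul, Complex.re_ofReal_mul]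
      simp only [Complex.mul_re, Complex.conj_re, Complex.conj_im]
      ring
    rw [e, Complex.sq_norm, Complex.sq_norm, Complex.normSq_apply, Complex.normSq_apply]
    simp only [Complex.sub_re, Complex.sub_im]
    push_cast
    ring
  rw [← h, mul_pow, ← pow_mul, ← pow_mul, mul_comm 2 k]
  ring

lemma integrable_poissonWeight_area (w : ℂ) (k : ℕ) :
    Integrable fun z : ℂ => poissonWeight k (Real.pi * ‖z - w‖ ^ 2) := by
  have h := integrableOn_poissonWeight k
  rw [IntegrableOn, ← map_area, integrable_map_measure
    (continuous_poissonWeight k).aestronglyMeasurable measurable_area.aemeasurable] at h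
  exact h.comp_sub_right w

lemma memLp_fockMonomial (w : ℂ) (k : ℕ) : MemLp (fockMonomial w k) 2 gaussianMeasure := by
  rw [memLp_two_iff_integrable_sq_norm
    (differentiable_fockMonomial w k).continuous.aestronglyMeasurable,
    integrable_gaussianMeasure_iff]
  simp only [smul_eq_mul, exp_mul_norm_fockMonomial_sq]
  exact integrable_poissonWeight_area w k

lemma measurableSet_area_sub {A : Set ℝ} (hA : MeasurableSet A) (w : ℂ) :
    MeasurableSet {z : ℂ | Real.pi * ‖z - w‖ ^ 2 ∈ A} :=
  (show Measurable fun z : ℂ => Real.pi * ‖z - w‖ ^ 2 by fun_prop) hA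

/-- The inner product of an entire function with a monomial over a radial set. -/
theorem setIntegral_mul_conj_fockMonomial {F : ℂ → ℂ} (hF : Differentiable ℂ F)
    (hFL : MemLp F 2 gaussianMeasure) {A : Set ℝ} (hA : MeasurableSet A) (hA0 : A ⊆ Set.Ioi 0)
    (w : ℂ) (k : ℕ) :
    ∫ z in {z : ℂ | Real.pi * ‖z - w‖ ^ 2 ∈ A}, F z * conj (fockMonomial w k z) ∂gaussianMeasure
      = (Real.sqrt (Real.pi ^ k / k.factorial) : ℂ) *
        (iteratedDeriv k (fockTranslate w F) 0 / k.factorial *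
          ((k.factorial / Real.pi ^ k * poissonMass A k : ℝ) : ℂ)) := by
  set B : Set ℂ := {z : ℂ | Real.pi * ‖z - w‖ ^ 2 ∈ A} with hB
  have hBm : MeasurableSet B := measurableSet_area_sub hA w
  set f : ℂ → ℂ := fun z => F z * conj (fockMonomial w k z) with hf
  set ρ : ℝ → ℝ := fun r => A.indicator (fun s => Real.exp (-s)) (Real.pi * r ^ 2) with hρ
  have hρm : Measurable ρ :=
    (Measurable.indicator (by fun_prop) hA).comp (by fun_prop : Measurable fun r => Real.pi * r ^ 2)
  have hpt : ∀ z : ℂ, (Real.exp (-Real.pi * ‖z + w‖ ^ 2) : ℂ) * B.indicator f (z + w)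
      = (Real.sqrt (Real.pi ^ k / k.factorial) : ℂ) *
        (fockTranslate w F z * (conj z ^ k * (ρ ‖z‖ : ℝ))) := by
    intro z
    by_cases hz : Real.pi * ‖z‖ ^ 2 ∈ A
    · have hzB : z + w ∈ B := by
        change Real.pi * ‖z + w - w‖ ^ 2 ∈ A
        rwa [add_sub_cancel_right]
      rw [Set.indicator_of_mem hzB]
      simp only [hρ]
      rw [Set.indicator_of_mem hz]
      exact exp_mul_conj_fockMonomial_mul w k F z
    · have hzB : z + w ∉ B := by
        change ¬ Real.pi * ‖z + w - w‖ ^ 2 ∈ A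
        rwa [add_sub_cancel_right]
      rw [Set.indicator_of_notMem hzB]
      simp only [hρ]
      rw [Set.indicator_of_notMem hz]
      simp
  have hfint : Integrable (B.indicator f) gaussianMeasure := by
    refine Integrable.indicator ?_ hBm
    exact hFL.integrable_mul ((memLp_fockMonomial w k).star)
  have hint : Integrable fun z : ℂ => fockTranslate w F z * (conj z ^ k * (ρ ‖z‖ : ℝ)) := by
    rw [integrable_gaussianMeasure_iff] at hfint
    have h := hfint.comp_add_right w
    simp only [Complex.real_smul, hpt] at h
    have hne : (Real.sqrt (Real.pi ^ k / k.factorial) : ℂ) ≠ 0 := by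
      rw [Complex.ofReal_ne_zero]; positivity
    exact (integrable_const_mul_iff hne.isUnit _).1 h
  -- Translating by `w` recentres the integral at the origin. The set `A` then enters only through
  -- the factor `poissonMass A k`, which is why the operator is diagonal.
  rw [← integral_indicator hBm, integral_gaussianMeasure, ← integral_add_right_eq_self
    (fun z => (Real.exp (-Real.pi * ‖z‖ ^ 2) : ℂ) * B.indicator f z) w, integral_congr_ae
    (ae_of_all _ hpt), integral_const_mul, integral_radial_mul_conj_pow (differentiable_fockTranslate w hF) k hρm
    hint, integral_complex_ofReal, integral_area_indicator hA hA0]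

lemma poissonMass_Ioi (k : ℕ) : poissonMass (Set.Ioi 0) k = 1 := integral_poissonWeight k

theorem integral_mul_conj_fockMonomial {F : ℂ → ℂ} (hF : Differentiable ℂ F)
    (hFL : MemLp F 2 gaussianMeasure) (w : ℂ) (k : ℕ) :
    ∫ z, F z * conj (fockMonomial w k z) ∂gaussianMeasure
      = (Real.sqrt (Real.pi ^ k / k.factorial) : ℂ) *
        (iteratedDeriv k (fockTranslate w F) 0 / k.factorial *
          ((k.factorial / Real.pi ^ k : ℝ) : ℂ)) := by
  -- The half-line corresponds to the whole plane without the point `w`.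
  have h := setIntegral_mul_conj_fockMonomial hF hFL measurableSet_Ioi subset_rfl w k
  rw [poissonMass_Ioi, mul_one, Measure.restrict_eq_self_of_ae_mem] at h
  · exact h
  · refine gaussianMeasure_absolutelyContinuous.ae_le ?_
    have : ∀ᵐ z : ℂ, z ≠ w := by rw [ae_iff]; simp
    filter_upwards [this] with z hz
    have := norm_pos_iff.2 (sub_ne_zero.2 hz)
    change 0 < Real.pi * ‖z - w‖ ^ 2
    positivity

/-- The monomials centred at `w`, as elements of the Fock space. -/
noncomputable def fockBasis (w : ℂ) (k : ℕ) : fockSpace :=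
  ⟨(memLp_fockMonomial w k).toLp _, fockMonomial w k, differentiable_fockMonomial w k,
    MemLp.coeFn_toLp _⟩

lemma coeFn_fockBasis (w : ℂ) (k : ℕ) :
    ((fockBasis w k : Lp ℂ 2 gaussianMeasure) : ℂ → ℂ) =ᵐ[gaussianMeasure] fockMonomial w k :=
  MemLp.coeFn_toLp (memLp_fockMonomial w k)

lemma inner_fockBasis_eq (w : ℂ) (k : ℕ) {f : Lp ℂ 2 gaussianMeasure} {F : ℂ → ℂ}
    (hf : f =ᵐ[gaussianMeasure] F) :
    inner ℂ (fockBasis w k : Lp ℂ 2 gaussianMeasure) f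
      = ∫ z, F z * conj (fockMonomial w k z) ∂gaussianMeasure := by
  rw [L2.inner_def]
  refine integral_congr_ae ?_
  filter_upwards [hf, coeFn_fockBasis w k] with z h1 h2
  rw [RCLike.inner_apply, h1, h2]

theorem orthonormal_fockBasis (w : ℂ) : Orthonormal ℂ (fockBasis w) := by
  rw [orthonormal_iff_ite]
  intro j k
  rw [Submodule.coe_inner, inner_fockBasis_eq w j (coeFn_fockBasis w k),
    integral_mul_conj_fockMonomial (differentiable_fockMonomial w k) (memLp_fockMonomial w k),
    fockTranslate_fockMonomial, iteratedDeriv_const_mul_field, iteratedDeriv_fun_pow_zero]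
  split_ifs with h1
  · subst h1
    have h3 : ((Real.sqrt (Real.pi ^ j / j.factorial) : ℝ) : ℂ) *
        (Real.sqrt (Real.pi ^ j / j.factorial) : ℝ) = (Real.pi ^ j / j.factorial : ℝ) := by
      rw [← Complex.ofReal_mul, Real.mul_self_sqrt (by positivity)]
    have h4 : (j.factorial : ℂ) ≠ 0 := by exact_mod_cast j.factorial_ne_zero
    have h5 : (Real.pi : ℂ) ≠ 0 := by exact_mod_cast Real.pi_ne_zero
    rw [mul_div_assoc, div_self h4, mul_one, ← mul_assoc, h3]
    push_cast
    field_simp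
  · simp

/-- The inner products are nonzero multiples of the Taylor coefficients of the translate of `F` at
`0`, and an entire function with zero Taylor series vanishes. -/
theorem eq_zero_of_inner_fockBasis (w : ℂ) (x : fockSpace)
    (hx : ∀ k, inner ℂ (fockBasis w k) x = 0) : x = 0 := by
  obtain ⟨F, hF, hxF⟩ := x.2
  have hFL : MemLp F 2 gaussianMeasure := (memLp_congr_ae hxF).1 (Lp.memLp _)
  have hc : ∀ k, iteratedDeriv k (fockTranslate w F) 0 = 0 := by
    intro k
    have h := hx k
    rw [Submodule.coe_inner, inner_fockBasis_eq w k hxF, integral_mul_conj_fockMonomial hF hFL] at h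
    have h1 : (Real.sqrt (Real.pi ^ k / k.factorial) : ℂ) ≠ 0 := by
      rw [Complex.ofReal_ne_zero]; positivity
    have h2 : ((k.factorial / Real.pi ^ k : ℝ) : ℂ) ≠ 0 := by
      rw [Complex.ofReal_ne_zero]; positivity
    have h3 : (k.factorial : ℂ) ≠ 0 := by exact_mod_cast k.factorial_ne_zero
    exact (div_eq_zero_iff.1 ((mul_eq_zero.1 ((mul_eq_zero.1 h).resolve_left h1)).resolve_right
      h2)).resolve_right h3
  have hz : ∀ z, F z = 0 := by
    intro z
    have h := Complex.taylorSeries_eq_of_entire (differentiable_fockTranslate w hF) 0 (z - w)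
    simp only [hc, smul_zero, tsum_zero, fockTranslate, sub_add_cancel] at h
    exact (mul_eq_zero.1 h.symm).resolve_right (Complex.exp_ne_zero _)
  refine Subtype.ext (Lp.ext ?_)
  refine hxF.trans (EventuallyEq.trans ?_ (Lp.coeFn_zero _ _ _).symm)
  exact ae_of_all _ hz

lemma coeFn_mulIndicator (Ω : Set ℂ) (hΩ : NullMeasurableSet Ω volume)
    (f : Lp ℂ 2 gaussianMeasure) :
    mulIndicator Ω hΩ f =ᵐ[gaussianMeasure] Ω.indicator f :=
  MemLp.coeFn_toLp
    ⟨(Lp.aestronglyMeasurable f).indicator₀ (hΩ.mono_ac gaussianMeasure_absolutelyContinuous),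
      (eLpNorm_indicator_le _).trans_lt (Lp.eLpNorm_lt_top f)⟩

/-- The Toeplitz operator of a radial set is diagonal in the basis of monomials. -/
theorem inner_fockBasis_toeplitz {Ω : Set ℂ} (hΩ : NullMeasurableSet Ω volume) {A : Set ℝ}
    (hA : MeasurableSet A) (hA0 : A ⊆ Set.Ioi 0) {w : ℂ}
    (hΩA : Ω =ᵐ[volume] {z : ℂ | Real.pi * ‖z - w‖ ^ 2 ∈ A}) (k : ℕ) (x : fockSpace) :
    inner ℂ (fockBasis w k) (toeplitz Ω hΩ x)
      = (poissonMass A k : ℂ) * inner ℂ (fockBasis w k) x := by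
  obtain ⟨F, hF, hxF⟩ := x.2
  have hFL : MemLp F 2 gaussianMeasure := (memLp_congr_ae hxF).1 (Lp.memLp _)
  have hBm := measurableSet_area_sub hA w
  have h1 : mulIndicator Ω hΩ (x : Lp ℂ 2 gaussianMeasure) =ᵐ[gaussianMeasure]
      Set.indicator {z : ℂ | Real.pi * ‖z - w‖ ^ 2 ∈ A} F := by
    filter_upwards [coeFn_mulIndicator Ω hΩ x, hxF,
      gaussianMeasure_absolutelyContinuous.ae_le hΩA] with z h2 h3 h4
    have h5 : z ∈ Ω ↔ z ∈ {z : ℂ | Real.pi * ‖z - w‖ ^ 2 ∈ A} := iff_of_eq h4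
    rw [h2]
    by_cases hz : z ∈ Ω
    · rw [Set.indicator_of_mem hz, Set.indicator_of_mem (h5.1 hz), h3]
    · rw [Set.indicator_of_notMem hz, Set.indicator_of_notMem (fun h => hz (h5.2 h))]
  -- The projection disappears against a vector that already lies in the Fock space.
  have h2 : inner ℂ (fockBasis w k) (toeplitz Ω hΩ x)
      = inner ℂ (fockBasis w k : Lp ℂ 2 gaussianMeasure)
        (mulIndicator Ω hΩ (x : Lp ℂ 2 gaussianMeasure)) :=
    Submodule.inner_orthogonalProjectionOnto_eq_of_mem_left _ _
  rw [h2, inner_fockBasis_eq w k h1, Submodule.coe_inner, inner_fockBasis_eq w k hxF,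
    integral_mul_conj_fockMonomial hF hFL]
  have h3 : ∀ z, Set.indicator {z : ℂ | Real.pi * ‖z - w‖ ^ 2 ∈ A} F z * conj (fockMonomial w k z)
      = Set.indicator {z : ℂ | Real.pi * ‖z - w‖ ^ 2 ∈ A}
        (fun z => F z * conj (fockMonomial w k z)) z := fun z => by
    rw [Set.indicator_mul_left]
  simp only [h3]
  rw [integral_indicator hBm, setIntegral_mul_conj_fockMonomial hF hFL hA hA0]
  push_cast
  ring

/-! ### The eigenvalue sequences -/

lemma sum_poissonMass {A : Set ℝ} (hA0 : A ⊆ Set.Ioi 0) (J : Finset ℕ) :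
    ∑ k ∈ J, poissonMass A k = ∫ s in A, poissonSum J s :=
  (integral_finsetSum J fun k _ => (integrableOn_poissonWeight k).mono_set hA0).symm

lemma poissonMass_pos {A : Set ℝ} (hA : MeasurableSet A) (hA0 : A ⊆ Set.Ioi 0)
    (hpos : 0 < volume A) (k : ℕ) : 0 < poissonMass A k := by
  rw [poissonMass, setIntegral_pos_iff_support_of_nonneg_ae _
    ((integrableOn_poissonWeight k).mono_set hA0)]
  · have hsupp : A ⊆ Function.support (poissonWeight k) := fun s hs =>
      (poissonWeight_pos k (hA0 hs)).ne'
    rwa [Set.inter_eq_right.2 hsupp]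
  · filter_upwards [ae_restrict_mem hA] with s hs using (poissonWeight_pos k (hA0 hs)).le

/-- The complement of `A` in the half-line has infinite measure, so it takes a positive share of the
total mass `1`. -/
lemma poissonMass_lt_one {A : Set ℝ} (hA : MeasurableSet A) (hA0 : A ⊆ Set.Ioi 0)
    (hfin : volume A < ⊤) (k : ℕ) : poissonMass A k < 1 := by
  have h1 : poissonMass (Set.Ioi 0 \ A) k + poissonMass A k = 1 := by
    rw [← poissonMass_Ioi k]
    unfold poissonMass
    rw [setIntegral_sdiff hA (integrableOn_poissonWeight k) hA0, sub_add_cancel]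
  have h2 : 0 < poissonMass (Set.Ioi 0 \ A) k := by
    refine poissonMass_pos (measurableSet_Ioi.diff hA) Set.sdiff_subset ?_ k
    rw [measure_sdiff hA0 hA.nullMeasurableSet hfin.ne, Real.volume_Ioi, ENNReal.top_sub hfin.ne]
    exact ENNReal.zero_lt_top
  linarith

/-- Integrate `∑ p_k = 1` over `A` term by term. The total depends only on the measure of `A`, as
the majorization argument requires. -/
lemma hasSum_poissonMass {A : Set ℝ} (hA : MeasurableSet A) (hA0 : A ⊆ Set.Ioi 0)
    (hfin : volume A < ⊤) : HasSum (poissonMass A) (volume A).toReal := by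
  have hint : ∀ k, Integrable (poissonWeight k) (volume.restrict A) := fun k =>
    (integrableOn_poissonWeight k).mono_set hA0
  have hnorm : ∀ k, ∫ s in A, ‖poissonWeight k s‖ = poissonMass A k := fun k =>
    setIntegral_congr_fun hA fun s hs =>
      Real.norm_of_nonneg (poissonWeight_nonneg k (le_of_lt (hA0 hs)))
  have hsum : Summable fun k => ∫ s in A, ‖poissonWeight k s‖ := by
    simp only [hnorm]
    refine summable_of_sum_range_le (c := (volume A).toReal)
      (fun k => setIntegral_nonneg hA fun s hs => poissonWeight_nonneg k (le_of_lt (hA0 hs)))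
      fun n => ?_
    rw [sum_poissonMass hA0]
    calc ∫ s in A, poissonSum (Finset.range n) s ≤ ∫ _s in A, (1 : ℝ) :=
          setIntegral_mono_on ((integrableOn_poissonSum _).mono_set hA0)
            (integrableOn_const hfin.ne) hA fun s hs => (poissonSum_range_lt_one (hA0 hs)).le
      _ = (volume A).toReal := by simp [measureReal_def]
  have h := hasSum_integral_of_summable_integral_norm hint hsum
  simp only [(hasSum_poissonWeight _).tsum_eq] at h
  rwa [setIntegral_const, smul_eq_mul, mul_one] at h

/-- Integrating `p_{k+1}' = p_k - p_{k+1}` over `(0, m)` gives `p_{k+1}(m) ≥ 0` as the difference of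
consecutive masses. -/
lemma antitone_poissonMass_Ioo {m : ℝ} (hm : 0 < m) : Antitone (poissonMass (Set.Ioo 0 m)) := by
  refine antitone_nat_of_succ_le fun k => ?_
  have i : ∀ j, IntegrableOn (poissonWeight j) (Set.Ioo 0 m) := fun j =>
    (integrableOn_poissonWeight j).mono_set Set.Ioo_subset_Ioi_self
  have h := intervalIntegral.integral_eq_sub_of_hasDerivAt (a := 0) (b := m)
    (fun s _ => hasDerivAt_poissonWeight (k + 1) s)
    (((continuous_poissonWeightPred _).sub (continuous_poissonWeight _)).intervalIntegrable _ _)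
  rw [intervalIntegral.integral_of_le hm.le, integral_Ioc_eq_integral_Ioo] at h
  have h2 : ∫ s in Set.Ioo 0 m, (poissonWeightPred (k + 1) s - poissonWeight (k + 1) s)
      = poissonMass (Set.Ioo 0 m) k - poissonMass (Set.Ioo 0 m) (k + 1) := integral_sub (i k) (i _)
  rw [h2, poissonWeight_zero_right, if_neg k.succ_ne_zero, sub_zero] at h
  linarith [poissonWeight_nonneg (k + 1) hm.le]

/-- The eigenvalues of the Toeplitz operator of a radial set. -/
theorem nthEigenvalue_toeplitz {Ω : Set ℂ} (hΩ : NullMeasurableSet Ω volume) {A : Set ℝ}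
    (hA : MeasurableSet A) (hA0 : A ⊆ Set.Ioi 0) (hpos : 0 < volume A) (hfin : volume A < ⊤)
    {w : ℂ} (hΩA : Ω =ᵐ[volume] {z : ℂ | Real.pi * ‖z - w‖ ^ 2 ∈ A}) {σ : Equiv.Perm ℕ}
    (hσ : Antitone (poissonMass A ∘ σ)) (n : ℕ) :
    nthEigenvalue (toeplitz Ω hΩ) (n + 1) = poissonMass A (σ n) :=
  nthEigenvalue_succ_eq (orthonormal_fockBasis w) (eq_zero_of_inner_fockBasis w)
    (inner_fockBasis_toeplitz hΩ hA hA0 hΩA) (poissonMass_pos hA hA0 hpos)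
    (hasSum_poissonMass hA hA0 hfin).summable.tendsto_atTop_zero hσ n

/-! ### Circularly symmetric sets up to null sets -/

/-- The map `z ↦ ‖z - w‖` pulls null sets back to null sets. -/
lemma ae_norm_sub_of_ae {p : ℝ → Prop} (h : ∀ᵐ r : ℝ, p r) (w : ℂ) : ∀ᵐ z : ℂ, p ‖z - w‖ := by
  set N := toMeasurable volume {r | ¬ p r}
  have hN : volume N = 0 := by rw [measure_toMeasurable]; exact h
  set A : Set ℝ := (fun s => Real.sqrt (s / Real.pi)) ⁻¹' N with hAdef
  have hA : MeasurableSet A := (by fun_prop : Measurable fun s : ℝ => Real.sqrt (s / Real.pi))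
    (measurableSet_toMeasurable _ _)
  -- In the area coordinate the exceptional radii lie in the image of a null set under the
  -- differentiable map `r ↦ π r²`, which is null.
  have hsub : A ∩ Set.Ioi 0 ⊆ (fun r : ℝ => Real.pi * r ^ 2) '' N := by
    rintro s ⟨hs, hs0⟩
    refine ⟨_, hs, ?_⟩
    change Real.pi * Real.sqrt (s / Real.pi) ^ 2 = s
    have : 0 < s := hs0
    rw [Real.sq_sqrt (by positivity), mul_div_cancel₀ _ Real.pi_ne_zero]
  have hA0 : volume (A ∩ Set.Ioi 0) = 0 := measure_mono_null hsub
    (addHaar_image_eq_zero_of_differentiableOn_of_addHaar_eq_zero volume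
      (Differentiable.differentiableOn (by fun_prop)) hN)
  rw [← volume_area_preimage hA w] at hA0
  rw [ae_iff]
  refine measure_mono_null (fun z hz => ?_) hA0
  change Real.sqrt (Real.pi * ‖z - w‖ ^ 2 / Real.pi) ∈ N
  rw [mul_div_cancel_left₀ _ Real.pi_ne_zero, Real.sqrt_sq (norm_nonneg _)]
  exact subset_toMeasurable _ _ hz

lemma IsCircularlySymmetric.exists_area_set {Ω : Set ℂ} (h : IsCircularlySymmetric Ω) :
    ∃ (w : ℂ) (A : Set ℝ), MeasurableSet A ∧ A ⊆ Set.Ioi 0 ∧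
      Ω =ᵐ[volume] {z : ℂ | Real.pi * ‖z - w‖ ^ 2 ∈ A} ∧ volume A = volume Ω := by
  obtain ⟨w, E, -, hE, rfl⟩ := h
  obtain ⟨E', -, hE', hEE'⟩ := hE.exists_measurable_superset_ae_eq
  set A : Set ℝ := (fun s => Real.sqrt (s / Real.pi)) ⁻¹' E' ∩ Set.Ioi 0 with hAdef
  have hA : MeasurableSet A := ((by fun_prop : Measurable fun s : ℝ => Real.sqrt (s / Real.pi))
    hE').inter measurableSet_Ioi
  have hae : {z : ℂ | ‖z - w‖ ∈ E} =ᵐ[volume] {z : ℂ | Real.pi * ‖z - w‖ ^ 2 ∈ A} := by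
    have hw : ∀ᵐ z : ℂ, z ≠ w := by rw [ae_iff]; simp
    filter_upwards [ae_norm_sub_of_ae hEE'.mem_iff w, hw] with z hz hzw
    have h0 : 0 < ‖z - w‖ := norm_pos_iff.2 (sub_ne_zero.2 hzw)
    refine propext (hz.symm.trans ⟨fun h => ⟨?_, ?_⟩, fun h => ?_⟩)
    · change Real.sqrt (Real.pi * ‖z - w‖ ^ 2 / Real.pi) ∈ E'
      rwa [mul_div_cancel_left₀ _ Real.pi_ne_zero, Real.sqrt_sq (norm_nonneg _)]
    · change 0 < Real.pi * ‖z - w‖ ^ 2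
      positivity
    · have h1 : Real.sqrt (Real.pi * ‖z - w‖ ^ 2 / Real.pi) ∈ E' := h.1
      rwa [mul_div_cancel_left₀ _ Real.pi_ne_zero, Real.sqrt_sq (norm_nonneg _)] at h1
  refine ⟨w, A, hA, Set.inter_subset_right, hae, ?_⟩
  rw [measure_congr hae, volume_area_preimage hA, Set.inter_eq_left.2 Set.inter_subset_right]

lemma ball_ae_eq_area {c : ℂ} {r : ℝ} (hr : 0 < r) :
    Metric.ball c r =ᵐ[volume] {z : ℂ | Real.pi * ‖z - c‖ ^ 2 ∈ Set.Ioo 0 (Real.pi * r ^ 2)} := by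
  have hw : ∀ᵐ z : ℂ, z ≠ c := by rw [ae_iff]; simp
  filter_upwards [hw] with z hz
  have h0 : 0 < ‖z - c‖ := norm_pos_iff.2 (sub_ne_zero.2 hz)
  change (z ∈ Metric.ball c r) = (Real.pi * ‖z - c‖ ^ 2 ∈ Set.Ioo 0 (Real.pi * r ^ 2))
  rw [mem_ball_iff_norm]
  refine propext ⟨fun h => ⟨by positivity, ?_⟩, fun h => ?_⟩
  · exact mul_lt_mul_of_pos_left (pow_lt_pow_left₀ h h0.le two_ne_zero) Real.pi_pos
  · exact lt_of_pow_lt_pow_left₀ 2 hr.le (lt_of_mul_lt_mul_left h.2 Real.pi_pos.le)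

lemma hasExtendedSum_iff {a : ℕ → ℝ} {S : EReal} : HasExtendedSum a S ↔
    Tendsto (fun N : ℕ => ((∑ i ∈ Finset.range N, a (i + 1) : ℝ) : EReal)) atTop (𝓝 S) := by
  have h : ∀ N, ∑ k ∈ Finset.Icc 1 N, a k = ∑ i ∈ Finset.range N, a (i + 1) := fun N => by
    rw [Finset.range_eq_Ico, Finset.sum_Ico_add' a 0 N 1]
    rfl
  simp only [HasExtendedSum, h]

lemma area_ae_eq_of_ae_eq {A B : Set ℝ} (hA : MeasurableSet A) (hB : MeasurableSet B)
    (h : A =ᵐ[volume] B) (w : ℂ) :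
    {z : ℂ | Real.pi * ‖z - w‖ ^ 2 ∈ A} =ᵐ[volume] {z : ℂ | Real.pi * ‖z - w‖ ^ 2 ∈ B} := by
  rw [← measure_symmDiff_eq_zero_iff] at h ⊢
  have h1 := volume_area_preimage (hA.symmDiff hB) w
  rw [measure_mono_null Set.inter_subset_left h] at h1
  exact h1

lemma image_add_ball (c w : ℂ) (r : ℝ) :
    (fun z => z + w) '' Metric.ball c r = Metric.ball (c + w) r := by
  simp [add_comm]

end Fock

/-! ### The comparison theorem -/

theorem theorem1p4 (Ω : Set ℂ) (hΩ : NullMeasurableSet Ω volume)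
    (hsymm : Fock.IsCircularlySymmetric Ω) (hpos : 0 < volume Ω) (hfin : volume Ω < ⊤)
    (c : ℂ) (r : ℝ) (hball : volume (Metric.ball c r) = volume Ω)
    (Φ : ℝ → ℝ) (hΦ : ConvexOn ℝ (Set.Ioo 0 1) Φ) :
    ∃ S S' : EReal,
      Fock.HasExtendedSum (fun k => Φ (Fock.nthEigenvalue (Fock.toeplitz Ω hΩ) k)) S ∧
      Fock.HasExtendedSum (fun k => Φ (Fock.nthEigenvalue (Fock.toeplitz (Metric.ball c r)
        measurableSet_ball.nullMeasurableSet) k)) S' ∧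
      S ≤ S' ∧
      (S' ≠ ⊥ → S' ≠ ⊤ →
        (¬ ∃ a b : ℝ, ∀ t ∈ Set.Ioo 0 (Fock.nthEigenvalue (Fock.toeplitz (Metric.ball c r)
          measurableSet_ball.nullMeasurableSet) 1), Φ t = a * t + b) →
        (S = S' ↔ ∃ w : ℂ,
          Fock.EquivalentSets Ω ((fun z => z + w) '' Metric.ball c r))) := by
  open Fock in
  have hr : 0 < r := by
    by_contra hr
    rw [Metric.ball_eq_empty.2 (not_lt.1 hr), measure_empty] at hball
    exact hpos.ne hball
  set m := Real.pi * r ^ 2 with hm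
  have hm0 : 0 < m := by positivity
  have hB0 : Set.Ioo 0 m ⊆ Set.Ioi 0 := Set.Ioo_subset_Ioi_self
  have hBm : MeasurableSet (Set.Ioo 0 m) := measurableSet_Ioo
  have hBpos : 0 < volume (Set.Ioo 0 m) := by simpa using hm0
  have hBfin : volume (Set.Ioo 0 m) < ⊤ := by simp
  have hvol : volume Ω = ENNReal.ofReal m := by
    rw [← hball, measure_congr (ball_ae_eq_area hr), volume_area_preimage hBm,
      Set.inter_eq_left.2 hB0, Real.volume_Ioo, sub_zero]
  obtain ⟨w, A, hA, hA0, hΩA, hAvol⟩ := hsymm.exists_area_set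
  have hApos : 0 < volume A := hAvol ▸ hpos
  have hAfin : volume A < ⊤ := hAvol ▸ hfin
  obtain ⟨σ, hσ⟩ := exists_perm_antitone (poissonMass_pos hA hA0 hApos)
    (hasSum_poissonMass hA hA0 hAfin).summable.tendsto_atTop_zero
  set a : ℕ → ℝ := poissonMass A ∘ σ with ha
  set b : ℕ → ℝ := poissonMass (Set.Ioo 0 m) with hb
  have hbanti : Antitone b := antitone_poissonMass_Ioo hm0
  have ea : ∀ n, nthEigenvalue (toeplitz Ω hΩ) (n + 1) = a n :=
    nthEigenvalue_toeplitz hΩ hA hA0 hApos hAfin hΩA hσ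
  have eb : ∀ n, nthEigenvalue (toeplitz (Metric.ball c r)
      measurableSet_ball.nullMeasurableSet) (n + 1) = b n :=
    nthEigenvalue_toeplitz _ hBm hB0 hBpos hBfin (ball_ae_eq_area hr) (σ := Equiv.refl ℕ) hbanti
  have ha01 : ∀ n, a n ∈ Set.Ioo (0 : ℝ) 1 := fun n =>
    ⟨poissonMass_pos hA hA0 hApos _, poissonMass_lt_one hA hA0 hAfin _⟩
  have hb01 : ∀ n, b n ∈ Set.Ioo (0 : ℝ) 1 := fun n =>
    ⟨poissonMass_pos hBm hB0 hBpos _, poissonMass_lt_one hBm hB0 hBfin _⟩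
  have hsa : HasSum a m := by
    have h := hasSum_poissonMass hA hA0 hAfin
    rw [hAvol, hvol, ENNReal.toReal_ofReal hm0.le] at h
    exact (Equiv.hasSum_iff σ).2 h
  have hsb : HasSum b m := by
    have h := hasSum_poissonMass hBm hB0 hBfin
    rwa [Real.volume_Ioo, sub_zero, ENNReal.toReal_ofReal hm0.le] at h
  have hcmp : ∀ n, n ≠ 0 → ∑ i ∈ Finset.range n, a i ≤ ∑ i ∈ Finset.range n, b i ∧
      (∑ i ∈ Finset.range n, a i = ∑ i ∈ Finset.range n, b i → A =ᵐ[volume] Set.Ioo 0 m) := by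
    intro n hn
    -- The indices `σ 0, …, σ (n-1)` are those of the `n` largest eigenvalues of `T_Ω`.
    have h := setIntegral_poissonSum_le hA hA0 hm0 (hAvol.trans hvol)
      (J := (Finset.range n).map σ.toEmbedding)
      ((Finset.nonempty_range_iff.2 hn).map)
    rwa [Finset.card_map, Finset.card_range, ← sum_poissonMass hA0, ← sum_poissonMass hB0,
      Finset.sum_map] at h
  have hmaj : ∀ n, ∑ i ∈ Finset.range n, a i ≤ ∑ i ∈ Finset.range n, b i := fun n => by
    by_cases hn : n = 0
    · simp [hn]
    · exact (hcmp n hn).1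
  obtain ⟨S, hS⟩ := exists_tendsto_sum_of_convexOn hΦ ha01 hsa.summable.tendsto_atTop_zero
  obtain ⟨S', hS'⟩ := exists_tendsto_sum_of_convexOn hΦ hb01 hsb.summable.tendsto_atTop_zero
  refine ⟨S, S', ?_, ?_, ?_, fun hbot htop haff => ⟨fun heq => ?_, ?_⟩⟩
  · rw [hasExtendedSum_iff]
    simpa only [ea] using hS
  · rw [hasExtendedSum_iff]
    simpa only [eb] using hS'
  · by_cases htop : S' = ⊤
    · rw [htop]; exact le_top
    · have h := add_sum_majorizationGain_le hΦ ha01 hb01 hσ hsa hsb hmaj hS hS' htop 0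
      simpa using h
  · rw [eb 0] at haff
    -- Were all nonempty partial sums strictly smaller, `Φ` would be affine up to the first
    -- eigenvalue `b 0` of the disc.
    have hex : ∃ n, n ≠ 0 ∧ ∑ i ∈ Finset.range n, a i = ∑ i ∈ Finset.range n, b i := by
      by_contra hno
      push Not at hno
      exact haff (exists_affine_of_sum_eq hΦ ha01 hb01 hσ hsa hsb
        (fun n hn => lt_of_le_of_ne (hmaj n) (hno n hn)) hS (heq ▸ hS') (heq ▸ htop) (heq ▸ hbot))
    obtain ⟨n, hn, hneq⟩ := hex
    have hAB := (hcmp n hn).2 hneq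
    -- The disc is moved from its centre `c` to the centre of symmetry `w`.
    refine ⟨w - c, ?_⟩
    rw [image_add_ball, add_sub_cancel, EquivalentSets, measure_symmDiff_eq_zero_iff]
    exact (hΩA.trans (area_ae_eq_of_ae_eq hA hBm hAB w)).trans (ball_ae_eq_area hr).symm
  · rintro ⟨v, hv⟩
    rw [image_add_ball, EquivalentSets, measure_symmDiff_eq_zero_iff] at hv
    -- A set equivalent to a translated disc is radial about the new centre `c + v` with the same
    -- area set `(0, m)`, so it has the eigenvalues of the disc.
    have eb' : ∀ n, nthEigenvalue (toeplitz Ω hΩ) (n + 1) = b n :=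
      nthEigenvalue_toeplitz hΩ hBm hB0 hBpos hBfin (hv.trans (ball_ae_eq_area hr))
        (σ := Equiv.refl ℕ) hbanti
    have hab : a = b := funext fun n => (ea n).symm.trans (eb' n)
    rw [hab] at hS
    exact tendsto_nhds_unique hS hS'
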